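/- Let $F=(R_1,\dots,R_n)$ be a family of $n$ (possibly overlapping, possibly equal) closed axis-aligned rectangles in $\mathbb{R}^2$. A point $p$ *dominates* a point $q$ if $p$ is strictly larger than $q$ in both coordinates, and $p$ dominates a rectangle if it dominates all of its points. The *inner Pareto front* $\mathrm{IPF}(F)$ is the set of all points $q$ such that, for every choice of points $p_1\in R_1,\dots,p_n\in R_n$, some $p_i$ dominates $q$. The rectangle $R_a$ has an *outgoing dependency* to $R_b$, where $b\neq a$, if there is a point $q\in R_b$ such that (I) the top-right corner of $R_b$ does not dominate $R_a$, (II) $q\notin\mathrm{IPF}(F)$, and (III) $q\in R_a$ or the top-right corner of $R_a$ dominates $q$. The rectangle $R_a$ is *independent* if it has no outgoing dependency to any $R_b$; let $I^0(F)$ be the set of (the indices of) the independent rectangles. **Lemma.** There is a single real RAM program that, given any $n$ and any family $F$ of $n$ closed axis-aligned rectangles (by the coordinates of their sides), computes $I^0(F)$ (as its characteristic vector) in $O(n\log n)$ time and with $O(n)$ memory cells in the worst case. Here each memory cell holds a real number or an integer word of $O(\log n)$ bits, and every arithmetic operation, comparison and indirect memory access takes unit time; there is no rounding of reals. -/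

import Mathlib

open scoped Asymptotics

/-! ## Geometry: rectangles, domination, the inner Pareto front, independent regions -/

namespace Pareto

/-- A closed axis-aligned rectangle in the plane. -/
structure Rectangle where
  left : ℝ
  right : ℝ
  bottom : ℝ
  top : ℝ
  left_le_right : left ≤ right
  bottom_le_top : bottom ≤ top

namespace Rectangle

/-- The points of the rectangle. -/
def region (R : Rectangle) : Set (ℝ × ℝ) :=
  {q | R.left ≤ q.1 ∧ q.1 ≤ R.right ∧ R.bottom ≤ q.2 ∧ q.2 ≤ R.top}

/-- The top-right corner of the rectangle. -/
def topRight (R : Rectangle) : ℝ × ℝ := (R.right, R.top)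

end Rectangle

/-- `p` dominates `q`: `p` lies in the open top-right quadrant of `q`. -/
def Dominates (p q : ℝ × ℝ) : Prop := q.1 < p.1 ∧ q.2 < p.2

/-- `p` dominates the rectangle `R`: `R` is contained in the open bottom-left quadrant of `p`. -/
def DominatesRegion (p : ℝ × ℝ) (R : Rectangle) : Prop := ∀ q ∈ R.region, Dominates p q

/-- `P` is a realization of the family `F`: it has one point in each region. -/
def Realizes {n : ℕ} (P : Fin n → ℝ × ℝ) (F : Fin n → Rectangle) : Prop :=
  ∀ i, P i ∈ (F i).region

/-- The inner Pareto front of `F`: the (open) area of the points that are dominated by some point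
of `P`, whatever the realization `P` of `F` is. -/
def innerPareto {n : ℕ} (F : Fin n → Rectangle) : Set (ℝ × ℝ) :=
  {q | ∀ P : Fin n → ℝ × ℝ, Realizes P F → ∃ i, Dominates (P i) q}

/-- The region with index `a` has an outgoing dependency to the region with index `b`.
The inner Pareto front is the open area below its staircase, so a point is above it when it is
outside that area. -/
def OutgoingDependency {n : ℕ} (F : Fin n → Rectangle) (a b : Fin n) : Prop :=
  b ≠ a ∧ ∃ q ∈ (F b).region,
    ¬ DominatesRegion (F b).topRight (F a) ∧
    q ∉ innerPareto F ∧
    (q ∈ (F a).region ∨ Dominates (F a).topRight q)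

/-- The (indices of the) independent regions of `F`: those without any outgoing dependency. -/
def independentRegions {n : ℕ} (F : Fin n → Rectangle) : Set (Fin n) :=
  {a | ∀ b, ¬ OutgoingDependency F a b}

end Pareto

/-! ## The real RAM

A random access machine with two kinds of memory: word memory, whose cells hold natural numbers
below `2 ^ w`, and real memory, whose cells hold real numbers. For each kind there are `k` registers
and `k` arrays, where `k` is fixed by the program. Every array has `L` cells, and array cells are
addressed indirectly, through word registers. Every instruction and every test takes one unit of
time. Reals can be added, subtracted, multiplied, divided and compared exactly; there is no
rounding and no conversion of reals to words. A word that does not fit into `w` bits, an array index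
that is not below `L`, and a division by zero are faults: the run is then undefined. -/

namespace RealRAM

/-- The contents of the memory: registers and arrays, for words and for reals. -/
structure Memory (k : ℕ) where
  wreg : Fin k → ℕ
  warr : Fin k → ℕ → ℕ
  rreg : Fin k → ℝ
  rarr : Fin k → ℕ → ℝ

/-- The arithmetic operations. -/
inductive Arith where
  | add
  | sub
  | mul
  | div

/-- Operations on words: subtraction stops at zero, division rounds down. -/
def Arith.onWords : Arith → ℕ → ℕ → Option ℕ
  | .add, x, y => some (x + y)
  | .sub, x, y => some (x - y)
  | .mul, x, y => some (x * y)
  | .div, x, y => if y = 0 then none else some (x / y)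

open scoped Classical in
/-- Exact operations on reals. -/
noncomputable def Arith.onReals : Arith → ℝ → ℝ → Option ℝ
  | .add, x, y => some (x + y)
  | .sub, x, y => some (x - y)
  | .mul, x, y => some (x * y)
  | .div, x, y => if y = 0 then none else some (x / y)

/-- The instructions. The first argument is always the target. -/
inductive Instr (k : ℕ) where
  /-- word register `d` := the constant `c` -/
  | wconst (d : Fin k) (c : ℕ)
  /-- word register `d` := word register `a` -/
  | wmove (d a : Fin k)
  /-- word register `d` := word register `a` `op` word register `b` -/
  | wop (op : Arith) (d a b : Fin k)
  /-- word register `d` := word array `A` at the index in word register `i` -/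
  | wload (d A i : Fin k)
  /-- word array `A` at the index in word register `i` := word register `a` -/
  | wstore (A i a : Fin k)
  /-- real register `d` := the constant `c` -/
  | rconst (d : Fin k) (c : ℚ)
  /-- real register `d` := real register `a` -/
  | rmove (d a : Fin k)
  /-- real register `d` := real register `a` `op` real register `b` -/
  | rop (op : Arith) (d a b : Fin k)
  /-- real register `d` := real array `A` at the index in word register `i` -/
  | rload (d A i : Fin k)
  /-- real array `A` at the index in word register `i` := real register `a` -/
  | rstore (A i a : Fin k)

/-- Store the word `v` in the word register `d`; a fault if `v` does not fit into `w` bits. -/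
def Memory.setWord {k : ℕ} (w : ℕ) (s : Memory k) (d : Fin k) (v : ℕ) : Option (Memory k) :=
  if v < 2 ^ w then some { s with wreg := Function.update s.wreg d v } else none

/-- The effect of one instruction on a machine with words of `w` bits and arrays of `L` cells;
`none` is a fault. -/
noncomputable def Instr.effect {k : ℕ} (w L : ℕ) : Instr k → Memory k → Option (Memory k)
  | .wconst d c, s => s.setWord w d c
  | .wmove d a, s => s.setWord w d (s.wreg a)
  | .wop op d a b, s => (op.onWords (s.wreg a) (s.wreg b)).bind (s.setWord w d)
  | .wload d A i, s => if s.wreg i < L then s.setWord w d (s.warr A (s.wreg i)) else none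
  | .wstore A i a, s =>
      if s.wreg i < L then
        some { s with
          warr := Function.update s.warr A (Function.update (s.warr A) (s.wreg i) (s.wreg a)) }
      else none
  | .rconst d c, s => some { s with rreg := Function.update s.rreg d (c : ℝ) }
  | .rmove d a, s => some { s with rreg := Function.update s.rreg d (s.rreg a) }
  | .rop op d a b, s => (op.onReals (s.rreg a) (s.rreg b)).map fun v =>
      { s with rreg := Function.update s.rreg d v }
  | .rload d A i, s =>
      if s.wreg i < L then
        some { s with rreg := Function.update s.rreg d (s.rarr A (s.wreg i)) }
      else none
  | .rstore A i a, s =>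
      if s.wreg i < L then
        some { s with
          rarr := Function.update s.rarr A (Function.update (s.rarr A) (s.wreg i) (s.rreg a)) }
      else none

/-- The tests: comparisons of two word registers or of two real registers. -/
inductive Test (k : ℕ) where
  | wlt (a b : Fin k)
  | wle (a b : Fin k)
  | weq (a b : Fin k)
  | wne (a b : Fin k)
  | rlt (a b : Fin k)
  | rle (a b : Fin k)
  | req (a b : Fin k)
  | rne (a b : Fin k)

/-- When a test succeeds. -/
def Test.Holds {k : ℕ} : Test k → Memory k → Prop
  | .wlt a b, s => s.wreg a < s.wreg b
  | .wle a b, s => s.wreg a ≤ s.wreg b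
  | .weq a b, s => s.wreg a = s.wreg b
  | .wne a b, s => s.wreg a ≠ s.wreg b
  | .rlt a b, s => s.rreg a < s.rreg b
  | .rle a b, s => s.rreg a ≤ s.rreg b
  | .req a b, s => s.rreg a = s.rreg b
  | .rne a b, s => s.rreg a ≠ s.rreg b

/-- Program code, with structured control flow. -/
inductive Code (k : ℕ) where
  | skip
  | instr (i : Instr k)
  | seq (c₁ c₂ : Code k)
  | ite (b : Test k) (c₁ c₂ : Code k)
  | loop (b : Test k) (c : Code k)

/-- `Run w L c s t s'`: on a machine with words of `w` bits and arrays of `L` cells, the code `c`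
started in the memory `s` halts without a fault after exactly `t` units of time, in the memory
`s'`. -/
inductive Run {k : ℕ} (w L : ℕ) : Code k → Memory k → ℕ → Memory k → Prop where
  | skip (s : Memory k) : Run w L .skip s 1 s
  | instr (i : Instr k) (s s' : Memory k) (h : i.effect w L s = some s') :
      Run w L (.instr i) s 1 s'
  | seq (c₁ c₂ : Code k) (s s' s'' : Memory k) (t₁ t₂ : ℕ)
      (h₁ : Run w L c₁ s t₁ s') (h₂ : Run w L c₂ s' t₂ s'') :
      Run w L (.seq c₁ c₂) s (t₁ + t₂) s''
  | iteTrue (b : Test k) (c₁ c₂ : Code k) (s s' : Memory k) (t : ℕ)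
      (hb : b.Holds s) (h : Run w L c₁ s t s') :
      Run w L (.ite b c₁ c₂) s (1 + t) s'
  | iteFalse (b : Test k) (c₁ c₂ : Code k) (s s' : Memory k) (t : ℕ)
      (hb : ¬ b.Holds s) (h : Run w L c₂ s t s') :
      Run w L (.ite b c₁ c₂) s (1 + t) s'
  | loopTrue (b : Test k) (c : Code k) (s s' s'' : Memory k) (t₁ t₂ : ℕ)
      (hb : b.Holds s) (h₁ : Run w L c s t₁ s') (h₂ : Run w L (.loop b c) s' t₂ s'') :
      Run w L (.loop b c) s (1 + t₁ + t₂) s''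
  | loopFalse (b : Test k) (c : Code k) (s : Memory k) (hb : ¬ b.Holds s) :
      Run w L (.loop b c) s 1 s

/-- The number of memory cells of a machine with `k` registers and `k` arrays of `L` cells, for
words and for reals. -/
def cells (k L : ℕ) : ℕ := 2 * k * (L + 1)

end RealRAM

namespace Pareto

open RealRAM

/-- The memory at the start: the number `n` of rectangles is in the word register `0`, the left,
right, bottom and top coordinates of the `i`-th rectangle are at the index `i` in the real arrays
`0`, `1`, `2`, `3`, and all other cells hold zero. -/
noncomputable def inputMemory (k : ℕ) {n : ℕ} (F : Fin n → Rectangle) : Memory (k + 4) where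
  wreg a := if a = 0 then n else 0
  warr _ _ := 0
  rreg _ := 0
  rarr A i :=
    if h : i < n then
      if A = 0 then (F ⟨i, h⟩).left
      else if A = 1 then (F ⟨i, h⟩).right
      else if A = 2 then (F ⟨i, h⟩).bottom
      else if A = 3 then (F ⟨i, h⟩).top
      else 0
    else 0

/-- The word array `0` starts with the characteristic vector of the set `I` of indices. -/
def HoldsSet {k n : ℕ} (s : Memory (k + 4)) (I : Set (Fin n)) : Prop :=
  ∀ i : Fin n, (i ∈ I → s.warr 0 i = 1) ∧ (i ∉ I → s.warr 0 i = 0)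

/-- The program `c` computes the independent regions of every family of `n` rectangles, for every
`n`, within `time n` units of time and with at most `space n` memory cells (input and output
included), on a machine whose words have `wordBits n` bits. -/
def ComputesIndependentRegions {k : ℕ} (c : Code (k + 4)) (wordBits time space : ℕ → ℕ) : Prop :=
  ∀ (n : ℕ) (F : Fin n → Rectangle),
    n < 2 ^ wordBits n ∧
    ∃ L : ℕ, n ≤ L ∧ cells (k + 4) L ≤ space n ∧
    ∃ (t : ℕ) (s : Memory (k + 4)),
      Run (wordBits n) L c (inputMemory k F) t s ∧
      t ≤ time n ∧
      HoldsSet s (independentRegions F)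

end Pareto

/-! The realization by bottom-left corners is the hardest to dominate with, so a point is outside
the inner Pareto front exactly when no bottom-left corner dominates it (`notMem_innerPareto_iff`).
Being outside is therefore preserved by moving right or up.

Write `l`, `r`, `b`, `t` for the sides. Condition (I) for a dependency from `a` to `c` says `r c ≤ r
a` or `t c ≤ t a`. If `r c < r a`, a witness can be moved to the right side of `c` and then lowered
to the least admissible height there, `entry c`: the maximum of `b c` and of all `b i` with `r c < l
i`. A dependency exists iff `entry c ≤ t c` and either `entry c < t a`, or `entry c = t a` and `l a
≤ r c`. The case `t c < t a` is the same with the coordinates swapped. Ties are delicate. If `r c =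
r a`, the right side of `c` is not strictly left of the corner of `a`, but for `t a ≤ t c` the
corner of `a` itself is a witness. So equal right sides are ordered by decreasing top, and equal
corners by an identifier whose sign differs in the two directions. Then each `c ≠ a` whose corner
does not dominate `a` precedes `a` in at least one of the two orders
(`exists_outgoingDependency_iff`).

Each direction takes one sort of the `2 * n` sides and two linear sweeps. The reverse sweep keeps
the maximum bottom of the left sides passed, which yields all entry heights (`SweptDown.right`). The
forward sweep keeps the least entry height `m` among the right sides with `entry c ≤ t c`, and the
last position `ρ` attaining it; this pair decides the existence of a suitable predecessor `c` in
constant time (`Best.sweepDependent_iff`).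

Sorting uses a tournament tree: the root is the least remaining item (`root_spec`), and after its
removal only the path above its leaf is recomputed (`ends_climb`), so the whole takes `O(n log n)`
time and linear space (`ends_sort`, `findIndependentTime_le`). Execution is verified by weakest
preconditions for loop-free code (`Ends.of_wp`) and by counted invariants for loops (`Ends.loop`).
-/

namespace RealRAM

/-! ### Program logic: timed postconditions, the loop rule, weakest preconditions. -/

variable {k : ℕ}

/-- The code `c`, started in `s`, halts within `T` units of time in a memory satisfying `Q`. -/
def Ends (w L : ℕ) (c : Code k) (s : Memory k) (T : ℕ) (Q : Memory k → Prop) : Prop :=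
  ∃ t s', Run w L c s t s' ∧ t ≤ T ∧ Q s'

theorem Ends.mono {w L : ℕ} {c : Code k} {s : Memory k} {T T' : ℕ} {Q Q' : Memory k → Prop}
    (h : Ends w L c s T Q) (hT : T ≤ T') (hQ : ∀ s', Q s' → Q' s') : Ends w L c s T' Q' := by
  obtain ⟨t, s', hr, ht, hq⟩ := h
  exact ⟨t, s', hr, ht.trans hT, hQ _ hq⟩

theorem Ends.seq {w L : ℕ} {c₁ c₂ : Code k} {s : Memory k} {T₁ T₂ : ℕ} {Q R : Memory k → Prop}
    (h₁ : Ends w L c₁ s T₁ R) (h₂ : ∀ s', R s' → Ends w L c₂ s' T₂ Q) :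
    Ends w L (.seq c₁ c₂) s (T₁ + T₂) Q := by
  obtain ⟨t, s', hr, ht, hq⟩ := h₁
  obtain ⟨t', s'', hr', ht', hq'⟩ := h₂ s' hq
  exact ⟨t + t', s'', .seq _ _ _ _ _ _ _ hr hr', by omega, hq'⟩

/-- A loop whose invariant carries the number of remaining iterations. -/
theorem Ends.loop {w L : ℕ} {b : Test k} {c : Code k} (I : ℕ → Memory k → Prop) (C : ℕ)
    (body : ∀ j s, I (j + 1) s → b.Holds s ∧ Ends w L c s C (I j))
    (done : ∀ s, I 0 s → ¬ b.Holds s) :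
    ∀ j s, I j s → Ends w L (.loop b c) s (j * (C + 1) + 1) (I 0) := by
  intro j
  induction j with
  | zero => exact fun s hs => ⟨1, s, .loopFalse _ _ _ (done s hs), by omega, hs⟩
  | succ j ih =>
    intro s hs
    obtain ⟨hb, t, s', hr, ht, hq⟩ := body j s hs
    obtain ⟨t', s'', hr', ht', hq'⟩ := ih s' hq
    refine ⟨1 + t + t', s'', .loopTrue _ _ _ _ _ _ _ hb hr hr', ?_, hq'⟩
    rw [add_mul]
    omega

/-- Sequential composition of a list of codes. -/
def block : List (Code k) → Code k
  | [] => .skip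
  | c :: cs => .seq c (block cs)

/-- The weakest precondition of loop-free code. -/
def wp (w L : ℕ) : Code k → (Memory k → Prop) → Memory k → Prop
  | .skip, Q, s => Q s
  | .instr i, Q, s => ∃ s', i.effect w L s = some s' ∧ Q s'
  | .seq c₁ c₂, Q, s => wp w L c₁ (wp w L c₂ Q) s
  | .ite b c₁ c₂, Q, s => (b.Holds s → wp w L c₁ Q s) ∧ (¬ b.Holds s → wp w L c₂ Q s)
  | .loop _ _, _, _ => False

/-- The worst-case running time of loop-free code. -/
def cost : Code k → ℕ
  | .skip => 1
  | .instr _ => 1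
  | .seq c₁ c₂ => cost c₁ + cost c₂
  | .ite _ c₁ c₂ => 1 + max (cost c₁) (cost c₂)
  -- A junk value: the weakest precondition of a loop is `False`, so `Ends.of_wp` never relies on
  -- it.
  | .loop _ _ => 0

/-- Induction on the code; a conditional is charged for its dearer branch, so the time bound does
not depend on the memory. -/
theorem Ends.of_wp {w L : ℕ} {c : Code k} {s : Memory k} {Q : Memory k → Prop}
    (h : wp w L c Q s) : Ends w L c s (cost c) Q := by
  induction c generalizing s Q with
  | skip => exact ⟨1, s, .skip s, le_rfl, h⟩
  | instr i =>
    obtain ⟨s', h, hq⟩ := h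
    exact ⟨1, s', .instr _ _ _ h, le_rfl, hq⟩
  | seq c₁ c₂ ih₁ ih₂ => exact (ih₁ h).seq fun s' hs' => ih₂ hs'
  | ite b c₁ c₂ ih₁ ih₂ =>
    by_cases hb : b.Holds s
    · obtain ⟨t, s', hr, ht, hq⟩ := ih₁ (h.1 hb)
      exact ⟨1 + t, s', .iteTrue _ _ _ _ _ _ hb hr, by simp only [cost]; omega, hq⟩
    · obtain ⟨t, s', hr, ht, hq⟩ := ih₂ (h.2 hb)
      exact ⟨1 + t, s', .iteFalse _ _ _ _ _ _ hb hr, by simp only [cost]; omega, hq⟩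
  | loop b c => exact h.elim

section wp

variable (w L : ℕ) (Q : Memory k → Prop) (s : Memory k)

theorem wp_skip : wp w L .skip Q s ↔ Q s := Iff.rfl

theorem wp_block_nil : wp w L (block []) Q s ↔ Q s := Iff.rfl

theorem wp_block_cons (c : Code k) (cs : List (Code k)) :
    wp w L (block (c :: cs)) Q s ↔ wp w L c (fun s' => wp w L (block cs) Q s') s := Iff.rfl

theorem wp_ite (b : Test k) (c₁ c₂ : Code k) :
    wp w L (.ite b c₁ c₂) Q s ↔
      (b.Holds s → wp w L c₁ Q s) ∧ (¬ b.Holds s → wp w L c₂ Q s) := Iff.rfl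

/-- This rule and the following ones let `simp` execute code symbolically. Every possible fault
(overflow, index out of range, zero divisor) surfaces as a conjunct to be discharged. -/
theorem wp_wconst (d : Fin k) (c : ℕ) :
    wp w L (.instr (.wconst d c)) Q s ↔
      c < 2 ^ w ∧ Q ⟨Function.update s.wreg d c, s.warr, s.rreg, s.rarr⟩ := by
  simp only [wp, Instr.effect, Memory.setWord]
  split_ifs with h <;> simp [h]

theorem wp_wmove (d a : Fin k) :
    wp w L (.instr (.wmove d a)) Q s ↔
      s.wreg a < 2 ^ w ∧ Q ⟨Function.update s.wreg d (s.wreg a), s.warr, s.rreg, s.rarr⟩ := by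
  simp only [wp, Instr.effect, Memory.setWord]
  split_ifs with h <;> simp [h]

theorem wp_wadd (d a b : Fin k) :
    wp w L (.instr (.wop .add d a b)) Q s ↔
      s.wreg a + s.wreg b < 2 ^ w ∧
        Q ⟨Function.update s.wreg d (s.wreg a + s.wreg b), s.warr, s.rreg, s.rarr⟩ := by
  simp only [wp, Instr.effect, Memory.setWord, Arith.onWords, Option.bind_some]
  split_ifs with h <;> simp [h]

theorem wp_wsub (d a b : Fin k) :
    wp w L (.instr (.wop .sub d a b)) Q s ↔
      s.wreg a - s.wreg b < 2 ^ w ∧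
        Q ⟨Function.update s.wreg d (s.wreg a - s.wreg b), s.warr, s.rreg, s.rarr⟩ := by
  simp only [wp, Instr.effect, Memory.setWord, Arith.onWords, Option.bind_some]
  split_ifs with h <;> simp [h]

theorem wp_wmul (d a b : Fin k) :
    wp w L (.instr (.wop .mul d a b)) Q s ↔
      s.wreg a * s.wreg b < 2 ^ w ∧
        Q ⟨Function.update s.wreg d (s.wreg a * s.wreg b), s.warr, s.rreg, s.rarr⟩ := by
  simp only [wp, Instr.effect, Memory.setWord, Arith.onWords, Option.bind_some]
  split_ifs with h <;> simp [h]

theorem wp_wdiv (d a b : Fin k) :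
    wp w L (.instr (.wop .div d a b)) Q s ↔
      s.wreg b ≠ 0 ∧ s.wreg a / s.wreg b < 2 ^ w ∧
        Q ⟨Function.update s.wreg d (s.wreg a / s.wreg b), s.warr, s.rreg, s.rarr⟩ := by
  simp only [wp, Instr.effect, Arith.onWords]
  split_ifs with h
  · simp [h]
  · simp only [Option.bind_some, Memory.setWord]
    split_ifs with h' <;> simp [h, h']

theorem wp_wload (d A i : Fin k) :
    wp w L (.instr (.wload d A i)) Q s ↔
      s.wreg i < L ∧ s.warr A (s.wreg i) < 2 ^ w ∧
        Q ⟨Function.update s.wreg d (s.warr A (s.wreg i)), s.warr, s.rreg, s.rarr⟩ := by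
  simp only [wp, Instr.effect, Memory.setWord]
  split_ifs with h h' <;> simp [*]

theorem wp_wstore (A i a : Fin k) :
    wp w L (.instr (.wstore A i a)) Q s ↔
      s.wreg i < L ∧
        Q ⟨s.wreg, Function.update s.warr A (Function.update (s.warr A) (s.wreg i) (s.wreg a)),
          s.rreg, s.rarr⟩ := by
  simp only [wp, Instr.effect]
  split_ifs with h <;> simp [h]

theorem wp_rconst (d : Fin k) (c : ℚ) :
    wp w L (.instr (.rconst d c)) Q s ↔
      Q ⟨s.wreg, s.warr, Function.update s.rreg d (c : ℝ), s.rarr⟩ := by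
  simp [wp, Instr.effect]

theorem wp_rmove (d a : Fin k) :
    wp w L (.instr (.rmove d a)) Q s ↔
      Q ⟨s.wreg, s.warr, Function.update s.rreg d (s.rreg a), s.rarr⟩ := by
  simp [wp, Instr.effect]

theorem wp_radd (d a b : Fin k) :
    wp w L (.instr (.rop .add d a b)) Q s ↔
      Q ⟨s.wreg, s.warr, Function.update s.rreg d (s.rreg a + s.rreg b), s.rarr⟩ := by
  simp [wp, Instr.effect, Arith.onReals]

theorem wp_rload (d A i : Fin k) :
    wp w L (.instr (.rload d A i)) Q s ↔
      s.wreg i < L ∧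
        Q ⟨s.wreg, s.warr, Function.update s.rreg d (s.rarr A (s.wreg i)), s.rarr⟩ := by
  simp only [wp, Instr.effect]
  split_ifs with h <;> simp [h]

theorem wp_rstore (A i a : Fin k) :
    wp w L (.instr (.rstore A i a)) Q s ↔
      s.wreg i < L ∧
        Q ⟨s.wreg, s.warr, s.rreg,
          Function.update s.rarr A (Function.update (s.rarr A) (s.wreg i) (s.rreg a))⟩ := by
  simp only [wp, Instr.effect]
  split_ifs with h <;> simp [h]

end wp

end RealRAM

/-! ### Geometry: dependencies as comparisons of entry heights. -/

namespace Pareto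

/-- The least height at which a point on the right side of the rectangle `c`, or on the upward
extension of that side, is at least as high as the bottom of `c` and outside the inner Pareto
front. -/
noncomputable def entry (l r b : ℕ → ℝ) (n c : ℕ) : ℝ :=
  (insert c ((Finset.range n).filter fun i => r c < l i)).sup' (Finset.insert_nonempty _ _) b

theorem entry_le_iff {l r b : ℕ → ℝ} {n c : ℕ} {z : ℝ} :
    entry l r b n c ≤ z ↔ b c ≤ z ∧ ∀ i < n, r c < l i → b i ≤ z := by
  simp [entry, Finset.sup'_le_iff]

/-- The order in which the right sides are swept. -/
def SweepsBefore (r t id : ℕ → ℝ) (c a : ℕ) : Prop :=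
  r c < r a ∨ r c = r a ∧ (t a < t c ∨ t a = t c ∧ id c < id a)

/-- The rectangle `a` has an outgoing dependency that the horizontal sweep detects. -/
def SweepDependent (l r b t id : ℕ → ℝ) (n a : ℕ) : Prop :=
  ∃ c < n, SweepsBefore r t id c a ∧ entry l r b n c ≤ t c ∧
    (entry l r b n c < t a ∨ entry l r b n c = t a ∧ l a ≤ r c)

/-- The bottom-left corner of a rectangle is below all its points in both coordinates, so what it
dominates is dominated by every choice in that rectangle. Hence the realization by these corners
alone decides membership. -/
theorem notMem_innerPareto_iff {n : ℕ} (F : Fin n → Rectangle) (q : ℝ × ℝ) :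
    q ∉ innerPareto F ↔ ∀ i, (F i).left ≤ q.1 ∨ (F i).bottom ≤ q.2 := by
  constructor
  · intro h i
    by_contra! hi
    refine h fun P hP => ⟨i, ?_, ?_⟩
    · exact hi.1.trans_le (hP i).1
    · exact hi.2.trans_le (hP i).2.2.1
  · intro h hq
    obtain ⟨i, hi⟩ := hq (fun i => ((F i).left, (F i).bottom)) fun i =>
      ⟨le_rfl, (F i).left_le_right, le_rfl, (F i).bottom_le_top⟩
    rcases h i with h | h
    · exact absurd hi.1 (not_lt.2 h)
    · exact absurd hi.2 (not_lt.2 h)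

/-- The top-right corner is the point of a rectangle that is hardest to dominate. -/
theorem dominatesRegion_topRight_iff (R S : Rectangle) :
    DominatesRegion R.topRight S ↔ S.right < R.right ∧ S.top < R.top := by
  constructor
  · intro h
    exact h (S.right, S.top) ⟨S.left_le_right, le_rfl, S.bottom_le_top, le_rfl⟩
  · rintro ⟨h₁, h₂⟩ q ⟨-, h₃, -, h₄⟩
    exact ⟨h₃.trans_lt h₁, h₄.trans_lt h₂⟩

/-- A dependency to a rectangle whose right side comes first in the sweep is detected. -/
theorem sweepDependent_of_point {l r b t id : ℕ → ℝ} {n a c : ℕ} (hc : c < n)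
    (h : SweepsBefore r t id c a) {x y : ℝ} (hx : x ≤ r c) (hy : b c ≤ y) (hy' : y ≤ t c)
    (hq : ∀ i < n, l i ≤ x ∨ b i ≤ y) (ha : l a ≤ x ∧ y ≤ t a ∨ y < t a) :
    SweepDependent l r b t id n a := by
  -- Since `x ≤ r c`, a left side beyond `r c` is also beyond `x`, so its rectangle can only satisfy
  -- the front condition through its bottom.
  have hG : entry l r b n c ≤ y := entry_le_iff.2 ⟨hy, fun i hi hl =>
    (hq i hi).resolve_left (not_le.2 (hx.trans_lt hl))⟩
  refine ⟨c, hc, h, hG.trans hy', ?_⟩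
  rcases ha with ha | ha
  · rcases (hG.trans ha.2).lt_or_eq with h | h
    · exact .inl h
    · exact .inr ⟨h, ha.1.trans hx⟩
  · exact .inl (hG.trans_lt ha)

/-- A dependency that the sweep detects is witnessed by a point. -/
theorem exists_point_of_sweepDependent {l r b t id : ℕ → ℝ} {n a : ℕ}
    (hx : ∀ i < n, l i ≤ r i) (hy : ∀ i < n, b i ≤ t i) (ha : a < n)
    (h : SweepDependent l r b t id n a) :
    ∃ c < n, c ≠ a ∧ r c ≤ r a ∧ ∃ x y, (l c ≤ x ∧ x ≤ r c ∧ b c ≤ y ∧ y ≤ t c) ∧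
      (∀ i < n, l i ≤ x ∨ b i ≤ y) ∧
      ((l a ≤ x ∧ x ≤ r a ∧ b a ≤ y ∧ y ≤ t a) ∨ x < r a ∧ y < t a) := by
  obtain ⟨c, hc, hca, hv, hG⟩ := h
  have hle := entry_le_iff.1 (le_refl (entry l r b n c))
  have hne : c ≠ a := by
    rintro rfl
    simp [SweepsBefore] at hca
  rcases hca with hr | ⟨hr, ht⟩
  -- The right side of `c` is strictly left of that of `a`: the entry point is dominated by the
  -- corner of `a`, or lies on the top edge of `a` when its height is `t a`.
  · refine ⟨c, hc, hne, hr.le, r c, entry l r b n c, ⟨hx c hc, le_rfl, hle.1, hv⟩, ?_, ?_⟩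
    · intro i hi
      exact (le_or_gt (l i) (r c)).imp_right (hle.2 i hi)
    · rcases hG with hG | ⟨hG, hl⟩
      · exact .inr ⟨hr, hG⟩
      · exact .inl ⟨hl, hr.le, by rw [hG]; exact hy a ha, hG.le⟩
  · have hG' : entry l r b n c ≤ t a := hG.elim le_of_lt fun h => h.1.le
    have hle' := entry_le_iff.1 hG'
    have ht' : t a ≤ t c := ht.elim le_of_lt fun h => h.1.le
    -- With `r c = r a` the entry point may fail to be strictly dominated. The corner of `a` serves
    -- instead: it lies in `c` because equal right sides are ordered by decreasing top, and it is
    -- above the entry height.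
    refine ⟨c, hc, hne, hr.le, r a, t a, ⟨hr ▸ hx c hc, hr.ge, hle'.1, ht'⟩, ?_, ?_⟩
    · intro i hi
      rw [← hr]
      exact (le_or_gt (l i) (r c)).imp_right (hle'.2 i hi)
    · exact .inl ⟨hx a ha, le_rfl, hy a ha, le_rfl⟩

/-- The dependencies are those detected by the horizontal or by the vertical sweep, provided that
the two sweeps break ties in opposite ways. -/
theorem exists_outgoingDependency_iff {n : ℕ} (F : Fin n → Rectangle) {l r b t : ℕ → ℝ}
    (hl : ∀ i : Fin n, l i = (F i).left) (hr : ∀ i : Fin n, r i = (F i).right)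
    (hb : ∀ i : Fin n, b i = (F i).bottom) (ht : ∀ i : Fin n, t i = (F i).top) (a : Fin n) :
    (∃ c, OutgoingDependency F a c) ↔
      SweepDependent l r b t (fun i => 1 * i) n a ∨
        SweepDependent b t l r (fun i => -1 * i) n a := by
  have hx : ∀ i < n, l i ≤ r i := fun i hi => by
    simpa [hl ⟨i, hi⟩, hr ⟨i, hi⟩] using (F ⟨i, hi⟩).left_le_right
  have hy : ∀ i < n, b i ≤ t i := fun i hi => by
    simpa [hb ⟨i, hi⟩, ht ⟨i, hi⟩] using (F ⟨i, hi⟩).bottom_le_top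
  constructor
  · rintro ⟨c, hca, ⟨x, y⟩, hq, hdom, hfront, ha⟩
    rw [dominatesRegion_topRight_iff] at hdom
    rw [notMem_innerPareto_iff] at hfront
    simp only [Rectangle.region, Set.mem_ofPred_eq, Rectangle.topRight, Dominates, ← hl, ← hr,
      ← hb, ← ht] at hq hdom hfront ha
    have hfront' : ∀ i < n, l i ≤ x ∨ b i ≤ y := fun i hi => hfront ⟨i, hi⟩
    have hX : SweepsBefore r t (fun i => 1 * i) c a →
        SweepDependent l r b t (fun i => 1 * i) n a := fun h =>
      sweepDependent_of_point c.2 h hq.2.1 hq.2.2.1 hq.2.2.2 hfront'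
        (ha.imp (fun h => ⟨h.1, h.2.2.2⟩) fun h => h.2)
    have hY : SweepsBefore t r (fun i => -1 * i) c a →
        SweepDependent b t l r (fun i => -1 * i) n a := fun h =>
      sweepDependent_of_point c.2 h hq.2.2.2 hq.1 hq.2.1 (fun i hi => (hfront' i hi).symm)
        (ha.imp (fun h => ⟨h.2.2.1, h.2.1⟩) fun h => h.1)
    have hid : ((c : ℕ) : ℝ) < ((a : ℕ) : ℝ) ∨ ((a : ℕ) : ℝ) < ((c : ℕ) : ℝ) := by
      simpa using lt_or_gt_of_ne hca
    -- In each case except `r a < r c` and `t a < t c`, which `hdom` excludes, `c` precedes `a` in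
    -- one of the two orders. For equal corners the opposite signs of the identifiers guarantee
    -- this.
    rcases lt_trichotomy (r c) (r a) with h | h | h
    · exact .inl (hX (.inl h))
    · rcases lt_trichotomy (t c) (t a) with h' | h' | h'
      · exact .inr (hY (.inl h'))
      · rcases hid with hid | hid
        · exact .inl (hX (.inr ⟨h, .inr ⟨h'.symm, by linarith⟩⟩))
        · exact .inr (hY (.inr ⟨h', .inr ⟨h.symm, by linarith⟩⟩))
      · exact .inl (hX (.inr ⟨h, .inl h'⟩))
    · rcases lt_trichotomy (t c) (t a) with h' | h' | h'
      · exact .inr (hY (.inl h'))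
      · exact .inr (hY (.inr ⟨h', .inl h⟩))
      · exact absurd ⟨h, h'⟩ hdom
  · rintro (h | h)
    · obtain ⟨c, hc, hca, hle, x, y, hq, hfront, ha⟩ := exists_point_of_sweepDependent hx hy a.2 h
      refine ⟨⟨c, hc⟩, fun h => hca (by simp [← h]), (x, y), ?_, ?_, ?_, ?_⟩
      · simpa [Rectangle.region, ← hl, ← hr, ← hb, ← ht] using hq
      · rw [dominatesRegion_topRight_iff, ← hr, ← hr]
        exact fun h => absurd h.1 (not_lt.2 hle)
      · rw [notMem_innerPareto_iff]
        intro i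
        simpa [← hl, ← hb] using hfront i i.2
      · simpa [Rectangle.region, Rectangle.topRight, Dominates, ← hl, ← hr, ← hb, ← ht] using ha
    · obtain ⟨c, hc, hca, hle, y, x, hq, hfront, ha⟩ := exists_point_of_sweepDependent hy hx a.2 h
      refine ⟨⟨c, hc⟩, fun h => hca (by simp [← h]), (x, y), ?_, ?_, ?_, ?_⟩
      · simpa [Rectangle.region, ← hl, ← hr, ← hb, ← ht] using
          ⟨hq.2.2.1, hq.2.2.2, hq.1, hq.2.1⟩
      · rw [dominatesRegion_topRight_iff, ← ht, ← ht]
        exact fun h => absurd h.2 (not_lt.2 hle)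
      · rw [notMem_innerPareto_iff]
        intro i
        simpa [← hl, ← hb] using (hfront i i.2).symm
      · simpa [Rectangle.region, Rectangle.topRight, Dominates, ← hl, ← hr, ← hb, ← ht] using
          ha.imp (fun h => ⟨h.2.2.1, h.2.2.2, h.1, h.2.1⟩) And.symm

end Pareto

/-! ### Tournament trees and selection in the order of the keys. -/

namespace Tournament

variable {α : Type*} [LinearOrder α] (key : ℕ → α)

/-- The one of the two items that has the smaller key. -/
def winner (x y : ℕ) : ℕ := if key y < key x then y else x

/-- The node `i` of the tree `T` holds the winner of its children. -/
def Consistent (T : ℕ → ℕ) (i : ℕ) : Prop := T i = winner key (T (2 * i)) (T (2 * i + 1))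

variable {key}

theorem winner_eq_or (x y : ℕ) : winner key x y = x ∨ winner key x y = y := by
  unfold winner; split_ifs <;> simp

theorem key_winner_le_left (x y : ℕ) : key (winner key x y) ≤ key x := by
  unfold winner; split_ifs with h
  · exact h.le
  · exact le_rfl

theorem key_winner_le_right (x y : ℕ) : key (winner key x y) ≤ key y := by
  unfold winner; split_ifs with h
  · exact le_rfl
  · exact not_lt.1 h

theorem winner_le {x y N : ℕ} (hx : x ≤ N) (hy : y ≤ N) : winner key x y ≤ N := by
  rcases winner_eq_or (key := key) x y with h | h <;> rw [h] <;> assumption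

theorem consistent_update_self {T : ℕ → ℕ} {p : ℕ} (hp : 1 ≤ p) :
    Consistent key (Function.update T p (winner key (T (2 * p)) (T (2 * p + 1)))) p := by
  rw [Consistent, Function.update_self, Function.update_of_ne (by omega),
    Function.update_of_ne (by omega)]

/-- A node occurs only in its own equation and in that of its parent, which has half its index. -/
theorem Consistent.update {T : ℕ → ℕ} {i p v : ℕ} (h : Consistent key T i) (hi : i ≠ p)
    (hi' : i ≠ p / 2) : Consistent key (Function.update T p v) i := by
  rw [Consistent, Function.update_of_ne hi, Function.update_of_ne (by omega),
    Function.update_of_ne (by omega)]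
  exact h

/-- Keys do not increase from a node to its parent. A node below `2 * N` has its parent below `N`,
so `N` need not be a power of two. -/
theorem key_root_le {T : ℕ → ℕ} {N : ℕ} (h : ∀ i, 1 ≤ i → i < N → Consistent key T i) (p : ℕ)
    (hp : 1 ≤ p) (hpN : p < 2 * N) : key (T 1) ≤ key (T p) := by
  induction p using Nat.strong_induction_on with
  | _ p ih =>
    rcases hp.eq_or_lt with rfl | hp1
    · exact le_rfl
    · refine (ih (p / 2) (by omega) (by omega) (by omega)).trans ?_
      rw [h (p / 2) (by omega) (by omega)]
      rcases Nat.even_or_odd' p with ⟨m, rfl | rfl⟩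
      · have : 2 * m / 2 = m := by omega
        rw [this]
        exact key_winner_le_left _ _
      · have : (2 * m + 1) / 2 = m := by omega
        rw [this]
        exact key_winner_le_right _ _

/-- Follow the winning child downwards; the index grows until it reaches the leaves, which start at
`N`. -/
theorem exists_leaf {T : ℕ → ℕ} {N : ℕ} (h : ∀ i, 1 ≤ i → i < N → Consistent key T i) (p : ℕ)
    (hp : 1 ≤ p) (hpN : p < 2 * N) : ∃ e < N, T p = T (N + e) := by
  induction hm : 2 * N - p using Nat.strong_induction_on generalizing p with
  | _ m ih =>
    by_cases hN : N ≤ p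
    · exact ⟨p - N, by omega, by rw [Nat.add_sub_cancel' hN]⟩
    · rcases winner_eq_or (key := key) (T (2 * p)) (T (2 * p + 1)) with hw | hw
      · rw [h p hp (by omega), hw]
        exact ih _ (by omega) (2 * p) (by omega) (by omega) rfl
      · rw [h p hp (by omega), hw]
        exact ih _ (by omega) (2 * p + 1) (by omega) (by omega) rfl

variable (key) in
/-- The first `j` entries of `ord` list the `j` smallest of the items below `N`, in the order of
their keys. -/
def Selected (N : ℕ) (ord : ℕ → ℕ) (j : ℕ) : Prop :=
  ∀ i < j, ord i < N ∧ (∀ i' < i, ord i' ≠ ord i) ∧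
    ∀ e < N, (∀ i' < i, ord i' ≠ e) → key (ord i) ≤ key e

theorem Selected.congr {N j : ℕ} {ord ord' : ℕ → ℕ} (h : Selected key N ord j)
    (ho : ∀ i < j, ord' i = ord i) : Selected key N ord' j := by
  intro i hi
  have : ∀ e, (∀ i' < i, ord' i' ≠ e) ↔ ∀ i' < i, ord i' ≠ e := fun e =>
    forall₂_congr fun i' hi' => by rw [ho i' (hi'.trans hi)]
  simp only [this, ho i hi]
  exact h i hi

theorem Selected.exists_unselected {N j : ℕ} {ord : ℕ → ℕ} (hj : j < N) :
    ∃ e < N, ∀ i < j, ord i ≠ e := by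
  have : ((Finset.range j).image ord).card < (Finset.range N).card :=
    Finset.card_image_le.trans_lt (by simpa using hj)
  obtain ⟨e, he, he'⟩ := Finset.exists_mem_notMem_of_card_lt_card this
  refine ⟨e, by simpa using he, fun i hi h => he' ?_⟩
  exact Finset.mem_image.2 ⟨i, by simpa using hi, h⟩

theorem Selected.injOn {N j : ℕ} {ord : ℕ → ℕ} (h : Selected key N ord j) {i i' : ℕ} (hi : i < j)
    (hi' : i' < j) (he : ord i = ord i') : i = i' := by
  rcases lt_trichotomy i i' with hlt | rfl | hlt
  · exact absurd he ((h i' hi').2.1 i hlt)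
  · rfl
  · exact absurd he.symm ((h i hi).2.1 i' hlt)

theorem Selected.exists_eq {N : ℕ} {ord : ℕ → ℕ} (h : Selected key N ord N) {e : ℕ} (he : e < N) :
    ∃ i < N, ord i = e := by
  have := Finset.surj_on_of_inj_on_of_card_le (s := Finset.range N) (t := Finset.range N)
    (fun i _ => ord i) (fun i hi => by simpa using (h i (by simpa using hi)).1)
    (fun i i' hi hi' he => h.injOn (by simpa using hi) (by simpa using hi') he) le_rfl e
    (by simpa using he)
  obtain ⟨i, hi, rfl⟩ := this
  exact ⟨i, by simpa using hi, rfl⟩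

theorem Selected.key_lt {N : ℕ} {ord : ℕ → ℕ} (h : Selected key N ord N)
    (hkey : ∀ e < N, ∀ e' < N, key e = key e' → e = e') {i i' : ℕ} (hi' : i' < N) (hlt : i < i') :
    key (ord i) < key (ord i') := by
  refine lt_of_le_of_ne ((h i (hlt.trans hi')).2.2 _ (h i' hi').1 fun i'' hi'' =>
    (h i' hi').2.1 i'' (hi''.trans hlt)) fun he => ?_
  exact (h i' hi').2.1 i hlt (hkey _ (h i (hlt.trans hi')).1 _ (h i' hi').1 he)

/-- Turns comparisons of positions in the sorted list into comparisons of keys; this is all that the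
sweeps use of sorting. -/
theorem Selected.lt_iff {N : ℕ} {ord : ℕ → ℕ} (h : Selected key N ord N)
    (hkey : ∀ e < N, ∀ e' < N, key e = key e' → e = e') {i i' : ℕ} (hi : i < N) (hi' : i' < N) :
    key (ord i) < key (ord i') ↔ i < i' := by
  refine ⟨fun hlt => ?_, h.key_lt hkey hi'⟩
  by_contra hle
  rcases (not_lt.1 hle).eq_or_lt with rfl | hgt
  · exact lt_irrefl _ hlt
  · exact lt_asymm hlt (h.key_lt hkey hi hgt)

/-- The leaves of the tree hold the items that are not among the first `j` entries of `ord`; the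
other leaves hold the sentinel `N`. -/
def Leaves (N : ℕ) (T ord : ℕ → ℕ) (j : ℕ) : Prop :=
  ∀ e < N, ((∃ i < j, ord i = e) → T (N + e) = N) ∧ ((∀ i < j, ord i ≠ e) → T (N + e) = e)

/-- While items are left, the root of a consistent tree holds the next one to be selected. -/
theorem root_spec {T ord : ℕ → ℕ} {N j : ℕ} (h : ∀ i, 1 ≤ i → i < N → Consistent key T i)
    (hleaf : Leaves N T ord j) (htop : ∀ e < N, key e < key N) (hj : j < N) :
    T 1 < N ∧ (∀ i < j, ord i ≠ T 1) ∧
      ∀ e < N, (∀ i < j, ord i ≠ e) → key (T 1) ≤ key e := by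
  have hmin : ∀ e < N, (∀ i < j, ord i ≠ e) → key (T 1) ≤ key e := fun e he hne => by
    have := key_root_le h (N + e) (by omega) (by omega)
    rwa [(hleaf e he).2 hne] at this
  obtain ⟨e, he, hne⟩ := Selected.exists_unselected (ord := ord) hj
  obtain ⟨e', he', h1⟩ := exists_leaf h 1 le_rfl (by omega)
  -- If the root's value came from an emptied leaf, it would be the sentinel, whose key exceeds that
  -- of the remaining item `e`.
  by_cases hsel : ∃ i < j, ord i = e'
  · rw [(hleaf e' he').1 hsel] at h1
    have := hmin e he hne
    rw [h1] at this
    exact absurd (htop e he) (not_lt.2 this)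
  · push Not at hsel
    rw [(hleaf e' he').2 hsel] at h1
    rw [h1] at hmin ⊢
    exact ⟨he', hsel, hmin⟩

theorem Selected.succ {N j : ℕ} {ord : ℕ → ℕ} (h : Selected key N ord j) {x : ℕ}
    (hx : x < N ∧ (∀ i < j, ord i ≠ x) ∧ ∀ e < N, (∀ i < j, ord i ≠ e) → key x ≤ key e) :
    Selected key N (Function.update ord j x) (j + 1) := by
  have hcongr : ∀ i < j, Function.update ord j x i = ord i := fun i hi =>
    Function.update_of_ne hi.ne _ _
  intro i hi
  rcases (Nat.lt_succ_iff.1 hi).eq_or_lt with rfl | hlt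
  · have : ∀ e, (∀ i' < i, Function.update ord i x i' ≠ e) ↔ ∀ i' < i, ord i' ≠ e := fun e =>
      forall₂_congr fun i' hi' => by rw [hcongr i' hi']
    simp only [this, Function.update_self]
    exact hx
  · exact h.congr hcongr i hlt

theorem Leaves.succ {N j : ℕ} {T ord : ℕ → ℕ} (h : Leaves N T ord j) (x : ℕ) :
    Leaves N (Function.update T (N + x) N) (Function.update ord j x) (j + 1) := by
  have hcongr : ∀ i < j, Function.update ord j x i = ord i := fun i hi =>
    Function.update_of_ne hi.ne _ _
  intro e he
  by_cases hex : e = x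
  · subst hex
    refine ⟨fun _ => by simp, fun hne => absurd (by simp) (hne j (by omega))⟩
  · rw [Function.update_of_ne (by omega)]
    constructor
    · rintro ⟨i, hi, rfl⟩
      refine (h _ he).1 ?_
      rcases (Nat.lt_succ_iff.1 hi).eq_or_lt with rfl | hlt
      · simp at hex
      · exact ⟨i, hlt, (hcongr i hlt).symm⟩
    · intro hne
      refine (h e he).2 fun i hi => ?_
      rw [← hcongr i hi]
      exact hne i (by omega)

end Tournament

/-! ### Lexicographic keys of the sides. -/

namespace Pareto

/-- The keys of the sides: the position, the type, the negated height and the identifier. -/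
abbrev SideKey := WithTop (ℝ ×ₗ ℝ ×ₗ ℝᵒᵈ ×ₗ ℝ)

/-- The key of the `e`-th side; the sentinel `N` has the greatest key. -/
noncomputable def sideKey (X Y Z W : ℕ → ℝ) (N e : ℕ) : SideKey :=
  if e = N then ⊤ else
    ((toLex (X e, toLex (Y e, toLex (OrderDual.toDual (Z e), W e))) : ℝ ×ₗ ℝ ×ₗ ℝᵒᵈ ×ₗ ℝ) :
      SideKey)

theorem sideKey_self (X Y Z W : ℕ → ℝ) (N : ℕ) : sideKey X Y Z W N N = ⊤ := by simp [sideKey]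

theorem sideKey_lt_top (X Y Z W : ℕ → ℝ) {N e : ℕ} (he : e ≠ N) :
    sideKey X Y Z W N e < ⊤ := by simp [sideKey, he]

theorem sideKey_lt_iff {X Y Z W : ℕ → ℝ} {N e f : ℕ} (he : e ≠ N) (hf : f ≠ N) :
    sideKey X Y Z W N e < sideKey X Y Z W N f ↔
      X e < X f ∨ X e = X f ∧ (Y e < Y f ∨ Y e = Y f ∧ (Z f < Z e ∨ Z e = Z f ∧ W e < W f)) := by
  simp [sideKey, he, hf, Prod.Lex.lt_iff]

/-- Only the type and the identifier are retained: together they already determine the side, so the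
keys are distinct. -/
theorem eq_of_sideKey_eq {X Y Z W : ℕ → ℝ} {N e f : ℕ} (he : e ≠ N) (hf : f ≠ N)
    (h : sideKey X Y Z W N e = sideKey X Y Z W N f) : Y e = Y f ∧ W e = W f := by
  simp [sideKey, he, hf] at h
  tauto

end Pareto

/-! ### Comparing two sides and recomputing one tree node. -/

namespace RealRAM

open Tournament Pareto

/-- The memory parts that sorting leaves unchanged: the word registers below `m`, the real registers
from `2` on, the real arrays, and the word arrays other than `1` and `2`. -/
structure Frame (m : ℕ) (s s' : Memory 16) : Prop where
  wreg : ∀ d : Fin 16, d.val < m → s'.wreg d = s.wreg d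
  rreg : ∀ d : Fin 16, 2 ≤ d.val → s'.rreg d = s.rreg d
  rarr : s'.rarr = s.rarr
  warr : ∀ A : Fin 16, A ≠ 1 → A ≠ 2 → s'.warr A = s.warr A

theorem Frame.refl (m : ℕ) (s : Memory 16) : Frame m s s :=
  ⟨fun _ _ => rfl, fun _ _ => rfl, rfl, fun _ _ _ => rfl⟩

theorem Frame.trans {m m' : ℕ} {s s' s'' : Memory 16} (h : Frame m s s') (h' : Frame m' s' s'')
    (hm : m ≤ m') : Frame m s s'' :=
  ⟨fun d hd => (h'.wreg d (hd.trans_le hm)).trans (h.wreg d hd),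
    fun d hd => (h'.rreg d hd).trans (h.rreg d hd), h'.rarr.trans h.rarr,
    fun A h₁ h₂ => (h'.warr A h₁ h₂).trans (h.warr A h₁ h₂)⟩

/-- Word register `6` becomes word register `7` if the real array `A` is smaller there, and stays
if it is greater; in case of equality, `c` decides. The registers `u`, `v` are `0`, `1` for the
order of the reals and `1`, `0` for the reverse order. -/
def compareOn (A u v : Fin 16) (c : Code 16) : Code 16 :=
  block [.instr (.rload u A 6), .instr (.rload v A 7),
    .ite (.rlt 1 0) (.instr (.wmove 6 7)) (.ite (.rlt 0 1) .skip c)]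

/-- Word register `6` becomes the winner of the word registers `6` and `7`. -/
def pick : Code 16 :=
  .ite (.weq 7 1) .skip (.ite (.weq 6 1) (.instr (.wmove 6 7))
    (compareOn 4 0 1 (compareOn 5 0 1 (compareOn 6 1 0 (compareOn 7 0 1 .skip)))))

/-- The keys of the sides, as held by the memory. -/
noncomputable def memKey (s : Memory 16) (N : ℕ) : ℕ → SideKey :=
  sideKey (s.rarr 4) (s.rarr 5) (s.rarr 6) (s.rarr 7) N

/-- Only the real registers `0` and `1` are overwritten. Quantifying over `rr`, which agrees with
the old registers from `2` on, lets the comparisons be chained without tracking those two. -/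
theorem wp_compareOn {w L : ℕ} {A u v : Fin 16} (huv : u = 0 ∧ v = 1 ∨ u = 1 ∧ v = 0)
    {c : Code 16} {Q : Memory 16 → Prop} {s : Memory 16} (hx : s.wreg 6 < L) (hy : s.wreg 7 < L)
    (hw : s.wreg 7 < 2 ^ w)
    (h : ∀ rr, (∀ d : Fin 16, 2 ≤ d.val → rr d = s.rreg d) →
      (if (if u = 0 then s.rarr A (s.wreg 7) < s.rarr A (s.wreg 6)
          else s.rarr A (s.wreg 6) < s.rarr A (s.wreg 7)) then
        Q ⟨Function.update s.wreg 6 (s.wreg 7), s.warr, rr, s.rarr⟩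
      else if s.rarr A (s.wreg 6) = s.rarr A (s.wreg 7) then wp w L c Q ⟨s.wreg, s.warr, rr, s.rarr⟩
      else Q ⟨s.wreg, s.warr, rr, s.rarr⟩)) :
    wp w L (compareOn A u v c) Q s := by
  have hf : ∀ x y : ℝ, ∀ d : Fin 16, 2 ≤ d.val →
      Function.update (Function.update s.rreg u x) v y d = s.rreg d := by
    intro x y d hd
    have h0 : d ≠ 0 := by rintro rfl; simp at hd
    have h1 : d ≠ 1 := by rintro rfl; simp at hd
    rcases huv with ⟨rfl, rfl⟩ | ⟨rfl, rfl⟩ <;> simp [h0, h1]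
  have h' := h _ (hf (s.rarr A (s.wreg 6)) (s.rarr A (s.wreg 7)))
  simp only [compareOn, wp_block_cons, wp_block_nil, wp_rload, wp_ite, wp_skip, wp_wmove,
    Test.Holds]
  refine ⟨hx, hy, ?_⟩
  rcases huv with ⟨rfl, rfl⟩ | ⟨rfl, rfl⟩
  · rcases lt_trichotomy (s.rarr A (s.wreg 6)) (s.rarr A (s.wreg 7)) with hlt | heq | hlt
    · simpa [hlt, hlt.not_gt, hlt.ne] using h'
    · simpa [heq] using h'
    · simpa [hlt, hlt.not_gt, hlt.ne', hw] using h'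
  · rcases lt_trichotomy (s.rarr A (s.wreg 6)) (s.rarr A (s.wreg 7)) with hlt | heq | hlt
    · simpa [hlt, hlt.not_gt, hlt.ne, hw] using h'
    · simpa [heq] using h'
    · simpa [hlt, hlt.not_gt, hlt.ne'] using h'

/-- The sentinel is tested by its index, because the key arrays store no key for it; otherwise four
comparisons follow the lexicographic order. -/
theorem wp_pick {w L N : ℕ} {s : Memory 16} {Q : Memory 16 → Prop} (hN : s.wreg 1 = N)
    (hx : s.wreg 6 ≤ N) (hy : s.wreg 7 ≤ N) (hL : N < L) (hw : N < 2 ^ w)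
    (h : ∀ rr, (∀ d : Fin 16, 2 ≤ d.val → rr d = s.rreg d) →
      Q ⟨Function.update s.wreg 6 (winner (memKey s N) (s.wreg 6) (s.wreg 7)), s.warr, rr,
        s.rarr⟩) :
    wp w L pick Q s := by
  have hy' : ∀ rr, (∀ d : Fin 16, 2 ≤ d.val → rr d = s.rreg d) →
      memKey s N (s.wreg 7) < memKey s N (s.wreg 6) →
      Q ⟨Function.update s.wreg 6 (s.wreg 7), s.warr, rr, s.rarr⟩ := fun rr hrr hlt => by
    have := h rr hrr
    rwa [winner, if_pos hlt] at this
  have hx' : ∀ rr, (∀ d : Fin 16, 2 ≤ d.val → rr d = s.rreg d) →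
      ¬ memKey s N (s.wreg 7) < memKey s N (s.wreg 6) →
      Q ⟨s.wreg, s.warr, rr, s.rarr⟩ := fun rr hrr hlt => by
    have := h rr hrr
    rwa [winner, if_neg hlt, Function.update_eq_self] at this
  have hyw : s.wreg 7 < 2 ^ w := by omega
  simp only [pick, wp_ite, wp_skip, wp_wmove, Test.Holds, hN]
  refine ⟨fun hyN => ?_, fun hyN => ⟨fun hxN => ⟨hyw, ?_⟩, fun hxN => ?_⟩⟩
  · exact hx' s.rreg (fun _ _ => rfl) (by rw [memKey, hyN, sideKey_self]; exact not_top_lt)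
  · exact hy' s.rreg (fun _ _ => rfl) (by
      rw [memKey, hxN, sideKey_self]; exact sideKey_lt_top _ _ _ _ hyN)
  · rw [memKey, sideKey_lt_iff hyN hxN] at hx' hy'
    have hxL : s.wreg 6 < L := by omega
    have hyL : s.wreg 7 < L := by omega
    refine wp_compareOn (.inl ⟨rfl, rfl⟩) hxL hyL hyw fun rr₁ hr₁ => ?_
    simp only [if_true]
    split_ifs with h₁ h₁'
    · exact hy' _ hr₁ (.inl h₁)
    · refine wp_compareOn (.inl ⟨rfl, rfl⟩) hxL hyL hyw fun rr₂ hr₂ => ?_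
      replace hr₂ := fun d hd => (hr₂ d hd).trans (hr₁ d hd)
      simp only [if_true]
      split_ifs with h₂ h₂'
      · exact hy' _ hr₂ (.inr ⟨h₁'.symm, .inl h₂⟩)
      -- The height is the component in the order dual, so the two registers are swapped.
      · refine wp_compareOn (.inr ⟨rfl, rfl⟩) hxL hyL hyw fun rr₃ hr₃ => ?_
        replace hr₃ := fun d hd => (hr₃ d hd).trans (hr₂ d hd)
        simp only [one_ne_zero, if_false]
        split_ifs with h₃ h₃'
        · exact hy' _ hr₃ (.inr ⟨h₁'.symm, .inr ⟨h₂'.symm, .inl h₃⟩⟩)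
        · refine wp_compareOn (.inl ⟨rfl, rfl⟩) hxL hyL hyw fun rr₄ hr₄ => ?_
          replace hr₄ := fun d hd => (hr₄ d hd).trans (hr₃ d hd)
          simp only [if_true, wp_skip]
          split_ifs with h₄ h₄'
          · exact hy' _ hr₄ (.inr ⟨h₁'.symm, .inr ⟨h₂'.symm, .inr ⟨h₃'.symm, h₄⟩⟩⟩)
          · exact hx' _ hr₄ (by tauto)
          · exact hx' _ hr₄ (by tauto)
        · refine hx' _ hr₃ ?_
          rintro (h | ⟨-, h | ⟨-, h | ⟨h, -⟩⟩⟩)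
          · exact h₁ h
          · exact h₂ h
          · exact h₃ h
          · exact h₃' h.symm
      · refine hx' _ hr₂ ?_
        rintro (h | ⟨-, h | ⟨h, -⟩⟩)
        · exact h₁ h
        · exact h₂ h
        · exact h₂' h.symm
    · refine hx' _ hr₁ ?_
      rintro (h | ⟨h, -⟩)
      · exact h₁ h
      · exact h₁' h.symm

/-- The tree node in word register `5` is computed from its children. -/
def refresh : Code 16 :=
  block [.instr (.wop .mul 8 5 3), .instr (.wload 6 1 8), .instr (.wop .add 8 8 2),
    .instr (.wload 7 1 8), pick, .instr (.wstore 1 5 6)]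

theorem wp_refresh {w L N : ℕ} {s : Memory 16} {Q : Memory 16 → Prop} (h1 : s.wreg 1 = N)
    (h2 : s.wreg 2 = 1) (h3 : s.wreg 3 = 2) (hL : 2 * N ≤ L) (hw : 2 * N < 2 ^ w)
    (hp : s.wreg 5 < N) (hx : s.warr 1 (2 * s.wreg 5) ≤ N) (hy : s.warr 1 (2 * s.wreg 5 + 1) ≤ N)
    (h : ∀ s', Frame 6 s s' → s'.warr = Function.update s.warr 1 (Function.update (s.warr 1)
      (s.wreg 5) (winner (memKey s N) (s.warr 1 (2 * s.wreg 5)) (s.warr 1 (2 * s.wreg 5 + 1)))) →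
      Q s') :
    wp w L refresh Q s := by
  simp only [refresh, wp_block_cons, wp_block_nil, wp_wmul, wp_wadd, wp_wload, wp_wstore]
  simp [h2, h3, mul_comm _ 2]
  refine ⟨by omega, by omega, by omega, by omega, by omega, by omega, ?_⟩
  refine wp_pick (N := N) (by simpa using h1) (by simpa using hx) (by simpa using hy) (by omega)
    (by omega) fun rr hrr => ?_
  simp at hrr ⊢
  refine ⟨by omega, h _ ⟨?_, ?_, rfl, ?_⟩ ?_⟩
  · intro d hd
    have h6 : d ≠ 6 := by rintro rfl; simp at hd
    have h7 : d ≠ 7 := by rintro rfl; simp at hd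
    have h8 : d ≠ 8 := by rintro rfl; simp at hd
    simp [h6, h7, h8]
  · exact hrr
  · intro A h _
    simp [h]
  · simp [memKey]

end RealRAM

/-! ### The tournament sort as a program. -/

namespace RealRAM

open Tournament Pareto

/-- The word registers `1`, `2`, `3` hold the number `N` of items and the constants `1` and `2`. -/
def Ready (N : ℕ) (s : Memory 16) : Prop := s.wreg 1 = N ∧ s.wreg 2 = 1 ∧ s.wreg 3 = 2

theorem Ready.of_frame {N m : ℕ} {s s' : Memory 16} (h : Ready N s) (hf : Frame m s s')
    (hm : 4 ≤ m) : Ready N s' :=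
  ⟨(hf.wreg 1 (by simp; omega)).trans h.1, (hf.wreg 2 (by simp; omega)).trans h.2.1,
    (hf.wreg 3 (by simp; omega)).trans h.2.2⟩

theorem Frame.memKey_eq {N m : ℕ} {s s' : Memory 16} (hf : Frame m s s') :
    memKey s' N = memKey s N := by
  simp only [memKey, hf.rarr]

/-- One step from a tree node to its parent, which is recomputed. -/
def climbStep : Code 16 := block [.instr (.wop .div 5 5 3), refresh]

/-- All proper ancestors of the tree node in word register `5` are recomputed. -/
def climb : Code 16 := .loop (.wlt 2 5) climbStep

/-- Invariant: only the parent of the current node can be inconsistent. Recomputing it passes the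
defect on to the grandparent, until at the root the parent has index `0` and there is no defect
left. The binary logarithm of the current index counts the remaining steps. -/
theorem ends_climb {w L N : ℕ} {s : Memory 16} (h : Ready N s) (hL : 2 * N < L)
    (hw : 2 * N + 2 < 2 ^ w) (hp : 1 ≤ s.wreg 5) (hpN : s.wreg 5 < 2 * N)
    (hcons : ∀ i, 1 ≤ i → i < N → i ≠ s.wreg 5 / 2 → Consistent (memKey s N) (s.warr 1) i)
    (hle : ∀ i, 1 ≤ i → i < 2 * N → s.warr 1 i ≤ N) :
    Ends w L climb s (Nat.log 2 (s.wreg 5) * (cost climbStep + 1) + 1) fun s' =>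
      Frame 5 s s' ∧ s'.warr 2 = s.warr 2 ∧ (∀ q, N ≤ q → s'.warr 1 q = s.warr 1 q) ∧
        (∀ i, 1 ≤ i → i < N → Consistent (memKey s N) (s'.warr 1) i) ∧
        ∀ i, 1 ≤ i → i < 2 * N → s'.warr 1 i ≤ N := by
  have key := Ends.loop (w := w) (L := L) (b := .wlt 2 5) (c := climbStep)
    (fun j s' => Frame 5 s s' ∧ s'.warr 2 = s.warr 2 ∧ (∀ q, N ≤ q → s'.warr 1 q = s.warr 1 q) ∧
      Nat.log 2 (s'.wreg 5) = j ∧ 1 ≤ s'.wreg 5 ∧ s'.wreg 5 < 2 * N ∧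
      (∀ i, 1 ≤ i → i < N → i ≠ s'.wreg 5 / 2 → Consistent (memKey s N) (s'.warr 1) i) ∧
      ∀ i, 1 ≤ i → i < 2 * N → s'.warr 1 i ≤ N) (cost climbStep) ?_ ?_ (Nat.log 2 (s.wreg 5)) s
    ⟨Frame.refl 5 s, rfl, fun _ _ => rfl, rfl, hp, hpN, hcons, hle⟩
  · refine key.mono le_rfl ?_
    rintro s' ⟨hf, hw2, hq, hlog, hp', -, hcons', hle'⟩
    refine ⟨hf, hw2, hq, fun i hi hiN => hcons' i hi hiN ?_, hle'⟩
    rw [Nat.log_eq_zero_iff] at hlog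
    omega
  · rintro j s' ⟨hf, hw2, hq, hlog, hp', hpN', hcons', hle'⟩
    have hr := h.of_frame hf (by omega)
    obtain ⟨hr1, hr2, hr3⟩ := id hr
    have hp1 : 1 < s'.wreg 5 := by
      by_contra hle
      have : s'.wreg 5 = 1 := by omega
      rw [this] at hlog
      simp at hlog
    refine ⟨by simp only [Test.Holds, hr2]; exact hp1, Ends.of_wp ?_⟩
    simp only [climbStep, wp_block_cons, wp_block_nil, wp_wdiv, hr3]
    refine ⟨by omega, by omega, ?_⟩
    refine wp_refresh (N := N) (by simpa using hr1) (by simpa using hr2) (by simpa using hr3)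
      hL.le (by omega) (by simp; omega) ?_ ?_ ?_
    · simp only [Function.update_self]
      exact hle' _ (by omega) (by omega)
    · simp only [Function.update_self]
      exact hle' _ (by omega) (by omega)
    intro s'' hf' hT
    simp only [Function.update_self, memKey] at hT
    rw [← memKey, hf.memKey_eq] at hT
    have h5 : s''.wreg 5 = s'.wreg 5 / 2 := by
      rw [hf'.wreg 5 (by simp)]; simp
    have hT1 := congrFun hT 1
    rw [Function.update_self] at hT1
    refine ⟨hf.trans (m' := 5) ⟨?_, hf'.rreg, hf'.rarr, hf'.warr⟩ le_rfl, ?_, ?_, ?_, ?_, ?_, ?_, ?_⟩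
    · intro d hd
      have hd5 : d ≠ 5 := by rintro rfl; simp at hd
      rw [hf'.wreg d (by omega)]
      simp [hd5]
    · rw [hT, ← hw2]
      simp
    · intro q hNq
      rw [hT1, Function.update_of_ne (by omega), hq q hNq]
    · rw [h5, Nat.log_div_base, hlog]
      rfl
    · omega
    · omega
    · intro i hi hiN hne
      rw [h5] at hne
      rw [hT1]
      by_cases hip : i = s'.wreg 5 / 2
      · subst hip
        exact consistent_update_self (by omega)
      · exact (hcons' i hi hiN hip).update hip hne
    · intro i hi hiN
      rw [hT1, Function.update_apply]
      split_ifs with hip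
      · exact winner_le (hle' _ (by omega) (by omega)) (hle' _ (by omega) (by omega))
      · exact hle' i hi hiN
  · rintro s' ⟨hf, -, -, hlog, -⟩
    have hr := h.of_frame hf (by omega)
    rw [Nat.log_eq_zero_iff] at hlog
    simp only [Test.Holds, hr.2.1]
    omega

def leavesStep : Code 16 :=
  block [.instr (.wop .add 5 1 4), .instr (.wstore 1 5 4), .instr (.wop .add 4 4 2)]

/-- The leaves of the tree are filled with the items. -/
def fillLeaves : Code 16 := block [.instr (.wconst 4 0), .loop (.wlt 4 1) leavesStep]

theorem ends_fillLeaves {w L N : ℕ} {s : Memory 16} (h : Ready N s) (hL : 2 * N < L)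
    (hw : 2 * N + 2 < 2 ^ w) :
    Ends w L fillLeaves s (1 + (N * (cost leavesStep + 1) + 1 + 1)) fun s' =>
      Frame 4 s s' ∧ ∀ e < N, s'.warr 1 (N + e) = e := by
  have key := Ends.loop (w := w) (L := L) (b := .wlt 4 1) (c := leavesStep)
    (fun j s' => Frame 4 s s' ∧ s'.wreg 4 + j = N ∧ ∀ e < s'.wreg 4, s'.warr 1 (N + e) = e)
    (cost leavesStep) ?_ ?_ N
  · refine Ends.seq (R := fun s' => Frame 4 s s' ∧ s'.wreg 4 + N = N ∧
      ∀ e < s'.wreg 4, s'.warr 1 (N + e) = e) (Ends.of_wp ?_) fun s' hs' =>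
      (key s' hs').seq fun s'' hs'' => Ends.of_wp ?_
    · rw [wp_wconst]
      refine ⟨by omega, ⟨?_, fun _ _ => rfl, rfl, fun _ _ _ => rfl⟩, by simp, by simp⟩
      intro d hd
      have hd4 : d ≠ 4 := by rintro rfl; simp at hd
      simp [hd4]
    · rw [wp_block_nil]
      obtain ⟨hf, h4, hT⟩ := hs''
      exact ⟨hf, fun e he => hT e (by omega)⟩
  · rintro j s' ⟨hf, h4, hT⟩
    obtain ⟨hr1, hr2, hr3⟩ := h.of_frame hf le_rfl
    refine ⟨by simp only [Test.Holds]; omega, Ends.of_wp ?_⟩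
    simp only [leavesStep, wp_block_cons, wp_block_nil, wp_wadd, wp_wstore]
    simp [hr1, hr2]
    refine ⟨by omega, by omega, by omega, hf.trans (m' := 4) ⟨?_, fun _ _ => rfl, rfl, ?_⟩ le_rfl,
      by omega, ?_⟩
    · intro d hd
      have hd4 : d ≠ 4 := by rintro rfl; simp at hd
      have hd5 : d ≠ 5 := by rintro rfl; simp at hd
      simp [hd4, hd5]
    · intro A hA _
      simp [hA]
    · intro e he
      rw [Function.update_apply]
      split_ifs with hN
      · omega
      · exact hT e (by omega)
  · rintro s' ⟨hf, h4, -⟩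
    have hr := h.of_frame hf le_rfl
    simp only [Test.Holds, hr.1]
    omega

def buildStep : Code 16 := block [.instr (.wop .sub 5 5 2), refresh]

/-- The inner nodes of the tree are computed, from the last one to the root. -/
def build : Code 16 := block [.instr (.wmove 5 1), .loop (.wlt 2 5) buildStep]

/-- Children have greater indices than their parent, so going down from `N - 1` each node is
computed after its children. -/
theorem ends_build {w L N : ℕ} {s : Memory 16} (h : Ready N s) (hL : 2 * N < L)
    (hw : 2 * N + 2 < 2 ^ w) (hT : ∀ e < N, s.warr 1 (N + e) = e) :
    Ends w L build s (1 + (N * (cost buildStep + 1) + 1 + 1)) fun s' =>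
      Frame 4 s s' ∧ (∀ e < N, s'.warr 1 (N + e) = e) ∧
        (∀ i, 1 ≤ i → i < N → Consistent (memKey s N) (s'.warr 1) i) ∧
        ∀ i, 1 ≤ i → i < 2 * N → s'.warr 1 i ≤ N := by
  have key := Ends.loop (w := w) (L := L) (b := .wlt 2 5) (c := buildStep)
    -- Truncated subtraction makes the count zero for both `N = 0` and `N = 1`, where there is no
    -- inner node.
    (fun j s' => Frame 4 s s' ∧ s'.wreg 5 - 1 = j ∧ s'.wreg 5 ≤ N ∧
      (∀ e < N, s'.warr 1 (N + e) = e) ∧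
      (∀ i, 1 ≤ i → s'.wreg 5 ≤ i → i < N → Consistent (memKey s N) (s'.warr 1) i) ∧
      ∀ i, 1 ≤ i → s'.wreg 5 ≤ i → i < 2 * N → s'.warr 1 i ≤ N) (cost buildStep) ?_ ?_ (N - 1)
  · refine Ends.mono (T := 1 + ((N - 1) * (cost buildStep + 1) + 1 + 1)) (Q := _) ?_
      (by gcongr; omega) fun _ h => h
    refine Ends.seq (Ends.of_wp (Q := fun s' => _) ?_) fun s' hs' =>
      (key s' hs').seq fun s'' hs'' => Ends.of_wp ?_
    · rw [wp_wmove, h.1]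
      refine ⟨by omega, ⟨?_, fun _ _ => rfl, rfl, fun _ _ _ => rfl⟩, by simp, by simp,
        by simpa using hT, ?_, ?_⟩
      · intro d hd
        have hd5 : d ≠ 5 := by rintro rfl; simp at hd
        simp [hd5]
      · simp
        intros
        omega
      · simp
        intro i _ hi hi'
        have := hT (i - N) (by omega)
        rw [Nat.add_sub_cancel' hi] at this
        omega
    · rw [wp_block_nil]
      obtain ⟨hf, h5, -, hT', hcons, hle⟩ := hs''
      exact ⟨hf, hT', fun i hi hiN => hcons i hi (by omega) hiN,
        fun i hi hiN => hle i hi (by omega) hiN⟩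
  · rintro j s' ⟨hf, h5, h5N, hT', hcons, hle⟩
    obtain ⟨hr1, hr2, hr3⟩ := h.of_frame hf le_rfl
    refine ⟨by simp only [Test.Holds]; omega, Ends.of_wp ?_⟩
    simp only [buildStep, wp_block_cons, wp_block_nil, wp_wsub, hr2]
    refine ⟨by omega, ?_⟩
    refine wp_refresh (N := N) (by simpa using hr1) (by simpa using hr2) (by simpa using hr3)
      hL.le (by omega) (by simp; omega) ?_ ?_ ?_
    · simp only [Function.update_self]
      exact hle _ (by omega) (by omega) (by omega)
    · simp only [Function.update_self]
      exact hle _ (by omega) (by omega) (by omega)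
    intro s'' hf' hU
    simp only [Function.update_self, memKey] at hU
    rw [← memKey, hf.memKey_eq] at hU
    have h5' : s''.wreg 5 = s'.wreg 5 - 1 := by
      rw [hf'.wreg 5 (by simp)]; simp
    have hU1 := congrFun hU 1
    rw [Function.update_self] at hU1
    refine ⟨hf.trans (m' := 4) ⟨?_, hf'.rreg, hf'.rarr, hf'.warr⟩ le_rfl, by omega, by omega,
      ?_, ?_, ?_⟩
    · intro d hd
      have hd5 : d ≠ 5 := by rintro rfl; simp at hd
      rw [hf'.wreg d (by omega)]
      simp [hd5]
    · intro e he
      rw [hU1, Function.update_of_ne (by omega), hT' e he]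
    · intro i hi hip hiN
      rw [hU1]
      by_cases hip' : i = s'.wreg 5 - 1
      · subst hip'
        exact consistent_update_self (by omega)
      · exact (hcons i hi (by omega) hiN).update hip' (by omega)
    · intro i hi hip hiN
      rw [hU1, Function.update_apply]
      split_ifs with hip'
      · exact winner_le (hle _ (by omega) (by omega) (by omega))
          (hle _ (by omega) (by omega) (by omega))
      · exact hle i hi (by omega) hiN
  · rintro s' ⟨hf, h5, -⟩
    have hr := h.of_frame hf le_rfl
    simp only [Test.Holds, hr.2.1]
    omega

/-- The winner is moved from its leaf to the entry of the output in word register `4`. -/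
def takeRoot : Code 16 :=
  block [.instr (.wload 6 1 2), .instr (.wstore 2 4 6), .instr (.wop .add 5 1 6),
    .instr (.wstore 1 5 1)]

def extractStep : Code 16 := block [takeRoot, climb, .instr (.wop .add 4 4 2)]

/-- The items are moved from the tree to the output, in the order of their keys. -/
def extract : Code 16 := block [.instr (.wconst 4 0), .loop (.wlt 4 1) extractStep]

/-- A step contains the loop `climb`, so `cost` does not apply to it. The climb starts at a leaf,
whose index is below `2 * N`. -/
def extractStepTime (N : ℕ) : ℕ :=
  cost takeRoot + (Nat.log 2 (2 * N) * (cost climbStep + 1) + 1 + (1 + 1))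

/-- Overwriting the winner's leaf by the sentinel damages only the path above that leaf, which
`climb` repairs; the new root is then the next item to select. -/
theorem ends_extract {w L N : ℕ} {s : Memory 16} (h : Ready N s) (hL : 2 * N < L)
    (hw : 2 * N + 2 < 2 ^ w) (hT : ∀ e < N, s.warr 1 (N + e) = e)
    (hcons : ∀ i, 1 ≤ i → i < N → Consistent (memKey s N) (s.warr 1) i)
    (hle : ∀ i, 1 ≤ i → i < 2 * N → s.warr 1 i ≤ N) :
    Ends w L extract s (1 + (N * (extractStepTime N + 1) + 1 + 1)) fun s' =>
      Frame 4 s s' ∧ Selected (memKey s N) N (s'.warr 2) N := by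
  have key := Ends.loop (w := w) (L := L) (b := .wlt 4 1) (c := extractStep)
    (fun j s' => Frame 4 s s' ∧ s'.wreg 4 + j = N ∧
      (∀ i, 1 ≤ i → i < N → Consistent (memKey s N) (s'.warr 1) i) ∧
      (∀ i, 1 ≤ i → i < 2 * N → s'.warr 1 i ≤ N) ∧
      Leaves N (s'.warr 1) (s'.warr 2) (s'.wreg 4) ∧
      Selected (memKey s N) N (s'.warr 2) (s'.wreg 4)) (extractStepTime N) ?_ ?_ N
  · refine Ends.seq (Ends.of_wp (Q := fun s' => _) ?_) fun s' hs' =>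
      (key s' hs').seq fun s'' hs'' => Ends.of_wp ?_
    · rw [wp_wconst]
      refine ⟨by omega, ⟨?_, fun _ _ => rfl, rfl, fun _ _ _ => rfl⟩, by simp, hcons, hle, ?_, ?_⟩
      · intro d hd
        have hd4 : d ≠ 4 := by rintro rfl; simp at hd
        simp [hd4]
      · intro e he
        simpa using hT e he
      · intro i hi
        simp at hi
    · rw [wp_block_nil]
      obtain ⟨hf, h4, -, -, -, hsel⟩ := hs''
      rw [show s''.wreg 4 = N by omega] at hsel
      exact ⟨hf, hsel⟩
  · rintro j s' ⟨hf, h4, hcons', hle', hleaf, hsel⟩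
    have hr := h.of_frame hf le_rfl
    obtain ⟨hr1, hr2, hr3⟩ := id hr
    refine ⟨by simp only [Test.Holds]; omega, ?_⟩
    have hroot := root_spec hcons' hleaf (fun e he => by
      rw [memKey, sideKey_self]
      exact sideKey_lt_top _ _ _ _ he.ne) (by omega)
    refine Ends.seq (R := fun s'' => Frame 5 s' s'' ∧ s''.wreg 5 = N + s'.warr 1 1 ∧
      s''.warr 1 = Function.update (s'.warr 1) (N + s'.warr 1 1) N ∧
      s''.warr 2 = Function.update (s'.warr 2) (s'.wreg 4) (s'.warr 1 1)) (Ends.of_wp ?_) ?_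
    · simp only [takeRoot, wp_block_cons, wp_block_nil, wp_wload, wp_wstore, wp_wadd]
      simp [hr1, hr2]
      refine ⟨by omega, by omega, by omega, by omega, by omega, ?_, fun _ _ => rfl, rfl, ?_⟩
      · intro d hd
        have hd5 : d ≠ 5 := by rintro rfl; simp at hd
        have hd6 : d ≠ 6 := by rintro rfl; simp at hd
        simp [hd5, hd6]
      · intro A h1 h2
        simp [h1, h2]
    rintro s₁ ⟨hf₁, h5, hw1, hw2⟩
    have hf₁' := hf.trans hf₁ (by omega)
    refine Ends.mono (T := (Nat.log 2 (s₁.wreg 5) * (cost climbStep + 1) + 1) + (1 + 1)) (Q := _)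
      ?_ ?_ fun _ h => h
    · refine Ends.seq (ends_climb (hr.of_frame hf₁ (by omega)) hL hw (by omega) (by omega) ?_ ?_)
        fun s₂ hs₂ => Ends.seq (Ends.of_wp (Q := fun s' => _) ?_) fun s₃ hs₃ => Ends.of_wp hs₃
      · intro i hi hiN hne
        rw [hf₁'.memKey_eq, hw1]
        exact (hcons' i hi hiN).update (by omega) (by rwa [h5] at hne)
      · intro i hi hiN
        rw [hw1, Function.update_apply]
        split_ifs
        · exact le_rfl
        · exact hle' i hi hiN
      · obtain ⟨hf₂, hw2₂, hq, hcons₂, hle₂⟩ := hs₂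
        rw [hf₁'.memKey_eq] at hcons₂
        have e4 : s₂.wreg 4 = s'.wreg 4 := by
          rw [hf₂.wreg 4 (by simp), hf₁.wreg 4 (by simp)]
        obtain ⟨-, e2, -⟩ := (hr.of_frame hf₁ (by omega)).of_frame hf₂ (by omega)
        rw [wp_wadd]
        simp only [e4, e2]
        refine ⟨by omega, (hf₁'.trans hf₂ (by omega)).trans (m' := 4) ⟨?_, fun _ _ => rfl, rfl,
          fun _ _ _ => rfl⟩ le_rfl, by simp; omega, hcons₂, hle₂, ?_, ?_⟩
        · intro d hd
          have hd4 : d ≠ 4 := by rintro rfl; simp at hd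
          simp [hd4]
        · have := hleaf.succ (s'.warr 1 1)
          rw [← hw1, ← hw2, ← hw2₂] at this
          simp only [Function.update_self]
          intro e he
          rw [hq _ (by omega)]
          exact this e he
        · simp only [Function.update_self]
          rw [hw2₂, hw2]
          exact hsel.succ hroot
    · gcongr
      omega
  · rintro s' ⟨hf, h4, -⟩
    have hr := h.of_frame hf le_rfl
    simp only [Test.Holds, hr.1]
    omega

/-- Word array `2` is filled with the items in the order of their keys. -/
def sort : Code 16 := block [fillLeaves, build, extract]

def sortTime (N : ℕ) : ℕ :=
  (1 + (N * (cost leavesStep + 1) + 1 + 1)) + ((1 + (N * (cost buildStep + 1) + 1 + 1)) +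
    ((1 + (N * (extractStepTime N + 1) + 1 + 1)) + 1))

theorem ends_sort {w L N : ℕ} {s : Memory 16} (h : Ready N s) (hL : 2 * N < L)
    (hw : 2 * N + 2 < 2 ^ w) :
    Ends w L sort s (sortTime N) fun s' =>
      Frame 4 s s' ∧ Selected (memKey s N) N (s'.warr 2) N := by
  refine (ends_fillLeaves h hL hw).seq fun s₁ ⟨hf₁, hT₁⟩ => ?_
  refine (ends_build (h.of_frame hf₁ le_rfl) hL hw hT₁).seq fun s₂ ⟨hf₂, hT₂, hc₂, hle₂⟩ => ?_
  rw [← hf₂.memKey_eq] at hc₂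
  refine (ends_extract ((h.of_frame hf₁ le_rfl).of_frame hf₂ le_rfl) hL hw hT₂ hc₂ hle₂).seq
    fun s₃ ⟨hf₃, hsel⟩ => Ends.of_wp ⟨(hf₁.trans hf₂ le_rfl).trans hf₃ le_rfl, ?_⟩
  rwa [hf₂.memKey_eq, hf₁.memKey_eq] at hsel

end RealRAM

/-! ### What sorting and the running minimum mean for the sweep. -/

namespace Pareto

open Tournament RealRAM

/-- For the first `m` of `n` rectangles, the memory holds the keys of the left sides, at the indices
below `n`, and of the right sides, at the indices from `n` on. It also holds a lower bound of the
bottoms and a strict upper bound of the tops. -/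
structure Loaded (l r b t id : ℕ → ℝ) (n m : ℕ) (s : Memory 16) : Prop where
  left : ∀ i < m, s.rarr 4 i = l i
  right : ∀ i < m, s.rarr 4 (n + i) = r i
  typeLeft : ∀ i < m, s.rarr 5 i = 0
  typeRight : ∀ i < m, s.rarr 5 (n + i) = 1
  bottom : ∀ i < m, s.rarr 6 i = b i
  top : ∀ i < m, s.rarr 6 (n + i) = t i
  idLeft : ∀ i < m, s.rarr 7 i = id i
  idRight : ∀ i < m, s.rarr 7 (n + i) = id i
  low : ∀ i < m, s.rreg 2 ≤ b i
  high : ∀ i < m, t i < s.rreg 3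

/-- `ord` lists the left sides, numbered from `0`, and the right sides, numbered from `n`, in the
order of the sweep. -/
structure SweepOrder (l r t id : ℕ → ℝ) (n : ℕ) (ord : ℕ → ℕ) : Prop where
  lt : ∀ j < 2 * n, ord j < 2 * n
  exists_eq : ∀ e < 2 * n, ∃ j < 2 * n, ord j = e
  right_left : ∀ i < n, ∀ i' < n, ∀ j < 2 * n, ∀ j' < 2 * n, ord j = n + i → ord j' = i' →
    (j < j' ↔ r i < l i')
  right_right : ∀ i < n, ∀ i' < n, ∀ j < 2 * n, ∀ j' < 2 * n, ord j = n + i → ord j' = n + i' →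
    (j < j' ↔ SweepsBefore r t id i i')

/-- At equal positions left sides, of type `0`, come before right sides, of type `1`; hence a right
side precedes a left side iff its position is strictly smaller. Between right sides the remaining
components, the negated top and the identifier, give exactly `SweepsBefore`. -/
theorem Loaded.sweepOrder {l r b t id : ℕ → ℝ} {n : ℕ} {s : Memory 16} {ord : ℕ → ℕ}
    (h : Loaded l r b t id n n s) (hid : ∀ i < n, ∀ i' < n, id i = id i' → i = i')
    (hs : Selected (memKey s (2 * n)) (2 * n) ord (2 * n)) : SweepOrder l r t id n ord := by
  have hkey : ∀ e < 2 * n, ∀ e' < 2 * n, memKey s (2 * n) e = memKey s (2 * n) e' → e = e' := by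
    intro e he e' he' heq
    obtain ⟨hY, hW⟩ := eq_of_sideKey_eq he.ne he'.ne heq
    rcases lt_or_ge e n with h₁ | h₁ <;> rcases lt_or_ge e' n with h₂ | h₂
    · rw [h.idLeft _ h₁, h.idLeft _ h₂] at hW
      exact hid _ h₁ _ h₂ hW
    · obtain ⟨i, rfl⟩ := Nat.exists_eq_add_of_le h₂
      rw [h.typeLeft _ h₁, h.typeRight _ (by omega)] at hY
      norm_num at hY
    · obtain ⟨i, rfl⟩ := Nat.exists_eq_add_of_le h₁
      rw [h.typeLeft _ h₂, h.typeRight _ (by omega)] at hY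
      norm_num at hY
    · obtain ⟨i, rfl⟩ := Nat.exists_eq_add_of_le h₁
      obtain ⟨i', rfl⟩ := Nat.exists_eq_add_of_le h₂
      rw [h.idRight _ (by omega), h.idRight _ (by omega)] at hW
      rw [hid _ (by omega) _ (by omega) hW]
  refine ⟨fun j hj => (hs j hj).1, fun e he => hs.exists_eq he, ?_, ?_⟩
  · rintro i hi i' hi' j hj j' hj' he he'
    rw [← hs.lt_iff hkey hj hj', he, he', memKey, sideKey_lt_iff (by omega) (by omega),
      h.right i hi, h.left i' hi', h.typeRight i hi, h.typeLeft i' hi']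
    norm_num
  · rintro i hi i' hi' j hj j' hj' he he'
    rw [← hs.lt_iff hkey hj hj', he, he', memKey, sideKey_lt_iff (by omega) (by omega),
      h.right i hi, h.right i' hi', h.typeRight i hi, h.typeRight i' hi', h.top i hi,
      h.top i' hi', h.idRight i hi, h.idRight i' hi']
    simp only [lt_irrefl, true_and, false_or, SweepsBefore, eq_comm]

/-- In the set `S` of right sides that the sweep has passed, `m` is the least entry height that does
not exceed the top, and `ρ` is the last position where it is attained. As long as there is none, `m`
exceeds all tops. -/
def Best (l r b t : ℕ → ℝ) (n : ℕ) (S : ℕ → Prop) (m ρ : ℝ) : Prop :=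
  (∀ c < n, S c → entry l r b n c ≤ t c →
    m ≤ entry l r b n c ∧ (entry l r b n c = m → r c ≤ ρ)) ∧
  ((∀ i < n, t i < m) ∨ ∃ c < n, S c ∧ entry l r b n c ≤ t c ∧ entry l r b n c = m ∧ r c = ρ)

/-- Lowering the entry height only helps detection, and at equal height a larger `r c` only helps `l
a ≤ r c`; so the least height with its last position is the best candidate. If there is no
candidate, `m` exceeds all tops and both tests fail. -/
theorem Best.sweepDependent_iff {l r b t id : ℕ → ℝ} {n a : ℕ} {S : ℕ → Prop} {m ρ : ℝ}
    (h : Best l r b t n S m ρ) (ha : a < n) (hS : ∀ c < n, S c ↔ SweepsBefore r t id c a) :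
    SweepDependent l r b t id n a ↔ m < t a ∨ m = t a ∧ l a ≤ ρ := by
  constructor
  · rintro ⟨c, hc, hca, hv, hG⟩
    obtain ⟨hm, hρ⟩ := h.1 c hc ((hS c hc).2 hca) hv
    rcases hG with hG | ⟨hG, hl⟩
    · exact .inl (hm.trans_lt hG)
    · rcases (hm.trans hG.le).lt_or_eq with hlt | heq
      · exact .inl hlt
      · exact .inr ⟨heq, hl.trans (hρ (hG.trans heq.symm))⟩
  · intro hm
    rcases h.2 with hlt | ⟨c, hc, hSc, hv, rfl, rfl⟩
    · have := hlt a ha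
      rcases hm with hm | hm
      · exact absurd hm this.not_gt
      · exact absurd hm.1 this.ne'
    · exact ⟨c, hc, (hS c hc).1 hSc, hv, hm⟩

/-- A tie `entry a = m` also replaces the candidate: the sweep goes to the right, so `r a` is the
larger position. -/
theorem Best.insert {l r b t : ℕ → ℝ} {n a : ℕ} {S S' : ℕ → Prop} {m ρ : ℝ}
    (h : Best l r b t n S m ρ) (ha : a < n) (hS' : ∀ c < n, S' c ↔ c = a ∨ S c)
    (hr : ∀ c < n, S c → r c ≤ r a) (hv : entry l r b n a ≤ t a) (hm : entry l r b n a ≤ m) :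
    Best l r b t n S' (entry l r b n a) (r a) := by
  refine ⟨fun c hc hSc hvc => ?_, .inr ⟨a, ha, (hS' a ha).2 (.inl rfl), hv, rfl, rfl⟩⟩
  rcases (hS' c hc).1 hSc with rfl | hSc
  · exact ⟨le_rfl, fun _ => le_rfl⟩
  · exact ⟨hm.trans (h.1 c hc hSc hvc).1, fun _ => hr c hc hSc⟩

theorem Best.insert_of_not {l r b t : ℕ → ℝ} {n a : ℕ} {S S' : ℕ → Prop} {m ρ : ℝ}
    (h : Best l r b t n S m ρ) (hS' : ∀ c < n, S' c ↔ c = a ∨ S c)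
    (hv : ¬ (entry l r b n a ≤ t a ∧ entry l r b n a ≤ m)) :
    Best l r b t n S' m ρ := by
  refine ⟨fun c hc hSc hvc => ?_, h.2.imp_right ?_⟩
  · rcases (hS' c hc).1 hSc with rfl | hSc
    · have : m < entry l r b n c := not_le.1 fun hle => hv ⟨hvc, hle⟩
      exact ⟨this.le, fun heq => absurd heq this.ne'⟩
    · exact h.1 c hc hSc hvc
  · rintro ⟨c, hc, hSc, hrest⟩
    exact ⟨c, hc, (hS' c hc).2 (.inr hSc), hrest⟩

theorem Best.congr {l r b t : ℕ → ℝ} {n : ℕ} {S S' : ℕ → Prop} {m ρ : ℝ}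
    (h : Best l r b t n S m ρ) (hS' : ∀ c < n, S' c ↔ S c) : Best l r b t n S' m ρ :=
  ⟨fun c hc hSc => h.1 c hc ((hS' c hc).1 hSc), h.2.imp_right fun ⟨c, hc, hSc, hrest⟩ =>
    ⟨c, hc, (hS' c hc).2 hSc, hrest⟩⟩

end Pareto

/-! ### Loading the keys of the sides. -/

namespace RealRAM

open Tournament Pareto

/-- The keys of the sides of the rectangle in word register `4` are stored. -/
def loadStep (A B C D : Fin 16) : Code 16 :=
  block [.instr (.wop .add 5 4 0), .instr (.rload 0 A 4), .instr (.rstore 4 4 0),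
    .instr (.rload 0 B 4), .instr (.rstore 4 5 0), .instr (.rstore 5 4 6), .instr (.rstore 5 5 7),
    .instr (.rload 0 C 4), .instr (.rstore 6 4 0), .ite (.rlt 0 2) (.instr (.rmove 2 0)) .skip,
    .instr (.rload 0 D 4), .instr (.rstore 6 5 0),
    -- Real register `7` holds `1`; the bound becomes the new top plus one and so stays strict.
    .ite (.rle 3 0) (.instr (.rop .add 3 0 7)) .skip,
    -- Words cannot be converted to reals, so the real identifier is built up by adding `σ` in each
    -- step.
    .instr (.rstore 7 4 4), .instr (.rstore 7 5 4), .instr (.rop .add 4 4 5),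
    .instr (.wop .add 4 4 2)]

def loadInit (σ : ℚ) : Code 16 :=
  block [.instr (.rconst 2 0), .instr (.rconst 3 0), .instr (.rconst 4 0), .instr (.rconst 5 σ),
    .instr (.rconst 6 0), .instr (.rconst 7 1), .instr (.wconst 4 0)]

/-- The keys of the sides are stored, for the rectangles whose left, right, bottom and top
coordinates are in the real arrays `A`, `B`, `C`, `D`. -/
def load (A B C D : Fin 16) (σ : ℚ) : Code 16 :=
  block [loadInit σ, .loop (.wlt 4 0) (loadStep A B C D)]

/-- The memory parts that each sweep leaves unchanged. -/
structure Keeps (s s' : Memory 16) : Prop where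
  wreg : ∀ d : Fin 16, d.val < 4 → s'.wreg d = s.wreg d
  rarr : ∀ A : Fin 16, A.val < 4 → s'.rarr A = s.rarr A

theorem Keeps.trans {s s' s'' : Memory 16} (h : Keeps s s') (h' : Keeps s' s'') : Keeps s s'' :=
  ⟨fun d hd => (h'.wreg d hd).trans (h.wreg d hd), fun d hd => (h'.rarr d hd).trans (h.rarr d hd)⟩

theorem Keeps.ready {s s' : Memory 16} {N : ℕ} (h : Keeps s s') (hr : Ready N s) : Ready N s' :=
  ⟨(h.wreg 1 (by simp)).trans hr.1, (h.wreg 2 (by simp)).trans hr.2.1,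
    (h.wreg 3 (by simp)).trans hr.2.2⟩

theorem Frame.keeps {s s' : Memory 16} (h : Frame 4 s s') : Keeps s s' :=
  ⟨h.wreg, fun A _ => by rw [h.rarr]⟩

theorem wp_loadStep {w L n : ℕ} {s : Memory 16} {l r b t : ℕ → ℝ} {σ : ℝ} {A B C D : Fin 16}
    {Q : Memory 16 → Prop}
    (hA : A.val < 4) (hB : B.val < 4) (hC : C.val < 4) (hD : D.val < 4) (hn : s.wreg 0 = n)
    (h2 : s.wreg 2 = 1) (hL : 2 * (2 * n) < L) (hw : 2 * (2 * n) + 2 < 2 ^ w)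
    (hl : s.rarr A = l) (hr' : s.rarr B = r) (hb : s.rarr C = b) (ht : s.rarr D = t)
    (h4 : s.rreg 4 = σ * s.wreg 4) (h5 : s.rreg 5 = σ) (h6 : s.rreg 6 = 0) (h7 : s.rreg 7 = 1)
    (hi : s.wreg 4 < n)
    (hQ : ∀ s' : Memory 16, (∀ d : Fin 16, d.val < 4 → s'.wreg d = s.wreg d) ∧
      (∀ E : Fin 16, E.val < 4 → s'.rarr E = s.rarr E) ∧ s'.warr = s.warr ∧
      s'.wreg 4 = s.wreg 4 + 1 ∧ s'.rreg 4 = σ * s.wreg 4 + σ ∧ s'.rreg 5 = σ ∧ s'.rreg 6 = 0 ∧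
      s'.rreg 7 = 1 ∧ (s'.rreg 2 ≤ s.rreg 2 ∧ s'.rreg 2 ≤ b (s.wreg 4)) ∧
      (s.rreg 3 ≤ s'.rreg 3 ∧ t (s.wreg 4) < s'.rreg 3) ∧
      s'.rarr 4 = Function.update (Function.update (s.rarr 4) (s.wreg 4) (l (s.wreg 4)))
        (s.wreg 4 + n) (r (s.wreg 4)) ∧
      s'.rarr 5 = Function.update (Function.update (s.rarr 5) (s.wreg 4) 0) (s.wreg 4 + n) 1 ∧
      s'.rarr 6 = Function.update (Function.update (s.rarr 6) (s.wreg 4) (b (s.wreg 4)))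
        (s.wreg 4 + n) (t (s.wreg 4)) ∧
      s'.rarr 7 = Function.update (Function.update (s.rarr 7) (s.wreg 4) (σ * s.wreg 4))
        (s.wreg 4 + n) (σ * s.wreg 4) → Q s') :
    wp w L (loadStep A B C D) Q s := by
  have ne : ∀ E : Fin 16, E.val < 4 → E ≠ 4 ∧ E ≠ 5 ∧ E ≠ 6 ∧ E ≠ 7 := by decide
  obtain ⟨a4, a5, a6, a7⟩ := ne A hA
  obtain ⟨b4, b5, b6, b7⟩ := ne B hB
  obtain ⟨c4, c5, c6, c7⟩ := ne C hC
  obtain ⟨d4, d5, d6, d7⟩ := ne D hD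
  simp only [loadStep, wp_block_cons, wp_block_nil, wp_rload, wp_rstore, wp_wadd, wp_radd, wp_ite,
    wp_skip, wp_rmove, Test.Holds]
  simp only [ne_eq, Fin.isValue, Fin.reduceEq, not_false_eq_true, Function.update_of_ne,
    Function.update_self, hn, h2, h4, h5, h6, h7, b4, c4, c5, d4, d5, d6, hl, hr', hb, ht]
  have i1 : s.wreg 4 + n < 2 ^ w := by omega
  have i2 : s.wreg 4 < L := by omega
  have i3 : s.wreg 4 + n < L := by omega
  have i4 : s.wreg 4 + 1 < 2 ^ w := by omega
  simp only [i1, i2, i3, i4, true_and]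
  have hwr : ∀ d : Fin 16, d.val < 4 → d ≠ 4 ∧ d ≠ 5 := fun d hd => ⟨(ne d hd).1, (ne d hd).2.1⟩
  refine ⟨fun hlo => ⟨fun hhi => ?_, fun hhi => ?_⟩, fun hlo => ⟨fun hhi => ?_, fun hhi => ?_⟩⟩
  all_goals
    refine hQ _ ⟨fun d hd => by simp [hwr d hd], fun E hE => by simp [ne E hE], rfl, ?_⟩
    simp [h5, h6, h7]
    try constructor
    all_goals linarith

theorem _root_.Pareto.Loaded.succ {n : ℕ} {s s' : Memory 16} {l r b t : ℕ → ℝ} {σ : ℝ}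
    (hi : s.wreg 4 < n) (h : Loaded l r b t (fun i => σ * i) n (s.wreg 4) s)
    (hlo : s'.rreg 2 ≤ s.rreg 2 ∧ s'.rreg 2 ≤ b (s.wreg 4))
    (hhi : s.rreg 3 ≤ s'.rreg 3 ∧ t (s.wreg 4) < s'.rreg 3)
    (k4 : s'.rarr 4 = Function.update (Function.update (s.rarr 4) (s.wreg 4) (l (s.wreg 4)))
      (s.wreg 4 + n) (r (s.wreg 4)))
    (k5 : s'.rarr 5 = Function.update (Function.update (s.rarr 5) (s.wreg 4) 0) (s.wreg 4 + n) 1)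
    (k6 : s'.rarr 6 = Function.update (Function.update (s.rarr 6) (s.wreg 4) (b (s.wreg 4)))
      (s.wreg 4 + n) (t (s.wreg 4)))
    (k7 : s'.rarr 7 = Function.update (Function.update (s.rarr 7) (s.wreg 4) (σ * s.wreg 4))
      (s.wreg 4 + n) (σ * s.wreg 4)) :
    Loaded l r b t (fun i => σ * i) n (s.wreg 4 + 1) s' := by
  -- All four key arrays receive one entry in each half, and the halves do not interfere because the
  -- index is below `n`.
  have upd : ∀ (f g : ℕ → ℝ) (x y : ℝ), g = Function.update (Function.update f (s.wreg 4) x)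
      (s.wreg 4 + n) y → ∀ v v' : ℕ → ℝ, (∀ i < s.wreg 4, f i = v i) →
      (∀ i < s.wreg 4, f (n + i) = v' i) → x = v (s.wreg 4) → y = v' (s.wreg 4) →
      (∀ i < s.wreg 4 + 1, g i = v i) ∧ ∀ i < s.wreg 4 + 1, g (n + i) = v' i := by
    rintro f g x y rfl v v' hv hv' rfl rfl
    constructor
    · intro i hi
      rw [Function.update_of_ne (by omega), Function.update_apply]
      split_ifs with heq
      · rw [heq]
      · exact hv i (by omega)
    · intro i hi
      rw [Function.update_apply, Function.update_of_ne (by omega)]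
      split_ifs with heq
      · rw [show i = s.wreg 4 by omega]
      · exact hv' i (by omega)
  have u4 := upd _ _ _ _ k4 l r h.left h.right rfl rfl
  have u5 := upd _ _ _ _ k5 (fun _ => 0) (fun _ => 1) h.typeLeft h.typeRight rfl rfl
  have u6 := upd _ _ _ _ k6 b t h.bottom h.top rfl rfl
  have u7 := upd _ _ _ _ k7 (fun i => σ * i) (fun i => σ * i) h.idLeft h.idRight rfl rfl
  refine ⟨u4.1, u4.2, u5.1, u5.2, u6.1, u6.2, u7.1, u7.2, ?_, ?_⟩
  · intro i hi
    rcases (Nat.lt_succ_iff.1 hi).eq_or_lt with rfl | hlt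
    · exact hlo.2
    · exact hlo.1.trans (h.low i hlt)
  · intro i hi
    rcases (Nat.lt_succ_iff.1 hi).eq_or_lt with rfl | hlt
    · exact hhi.2
    · exact (h.high i hlt).trans_le hhi.1

theorem ends_load {w L n : ℕ} {s : Memory 16} {l r b t : ℕ → ℝ} (σ : ℚ) {A B C D : Fin 16}
    (hA : A.val < 4) (hB : B.val < 4) (hC : C.val < 4) (hD : D.val < 4) (hn : s.wreg 0 = n)
    (hr : Ready (2 * n) s) (hL : 2 * (2 * n) < L) (hw : 2 * (2 * n) + 2 < 2 ^ w)
    (hl : s.rarr A = l) (hr' : s.rarr B = r) (hb : s.rarr C = b) (ht : s.rarr D = t) :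
    Ends w L (load A B C D σ) s (cost (loadInit σ) + (n * (cost (loadStep A B C D) + 1) + 1 + 1))
      fun s' => Keeps s s' ∧ s'.warr = s.warr ∧ Loaded l r b t (fun i => σ * i) n n s' := by
  have key := Ends.loop (w := w) (L := L) (b := .wlt 4 0) (c := loadStep A B C D)
    (fun j s' => Keeps s s' ∧ s'.warr = s.warr ∧ s'.wreg 4 + j = n ∧ s'.rreg 4 = σ * s'.wreg 4 ∧
      s'.rreg 5 = σ ∧ s'.rreg 6 = 0 ∧ s'.rreg 7 = 1 ∧
      Loaded l r b t (fun i => σ * i) n (s'.wreg 4) s') (cost (loadStep A B C D)) ?_ ?_ n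
  · refine Ends.seq (Ends.of_wp (Q := fun s' => _) ?_) fun s' hs' =>
      (key s' hs').seq fun s'' hs'' => Ends.of_wp ?_
    · simp only [loadInit, wp_block_cons, wp_block_nil, wp_rconst, wp_wconst]
      refine ⟨by omega, ⟨?_, fun _ _ => rfl⟩, trivial, by simp, by simp, by simp, by simp, by simp, ?_⟩
      · intro d hd
        have hd4 : d ≠ 4 := by rintro rfl; simp at hd
        simp [hd4]
      · constructor <;> simp
    · rw [wp_block_nil]
      obtain ⟨hk, hwa, h4, -, -, -, -, h⟩ := hs''
      rw [show s''.wreg 4 = n by omega] at h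
      exact ⟨hk, hwa, h⟩
  · rintro j s' ⟨hk, hwa, h4, q4, q5, q6, q7, h⟩
    have hn' : s'.wreg 0 = n := (hk.wreg 0 (by simp)).trans hn
    refine ⟨by simp only [Test.Holds, hn']; omega, Ends.of_wp (wp_loadStep hA hB hC hD hn'
      (hk.ready hr).2.1 hL hw ((hk.rarr A hA).trans hl) ((hk.rarr B hB).trans hr')
      ((hk.rarr C hC).trans hb) ((hk.rarr D hD).trans ht) q4 q5 q6 q7 (by omega) ?_)⟩
    rintro s'' ⟨hwr, hra, hwa', h4', q4', q5', q6', q7', hlo, hhi, k4, k5, k6, k7⟩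
    refine ⟨hk.trans ⟨hwr, hra⟩, hwa'.trans hwa, by omega, ?_, q5', q6', q7', ?_⟩
    · rw [q4', h4']; push_cast; ring
    · rw [h4']
      exact h.succ (by omega) hlo hhi k4 k5 k6 k7
  · rintro s' ⟨hk, -, h4, -⟩
    simp only [Test.Holds, (hk.wreg 0 (by simp)).trans hn]
    omega

end RealRAM

/-! ### The reverse sweep: entry heights. -/

namespace RealRAM

open Tournament Pareto

def sweepDownStep : Code 16 :=
  block [.instr (.wop .sub 4 4 2), .instr (.wload 5 2 4),
    .ite (.wlt 5 0)
      (block [.instr (.rload 0 6 5), .ite (.rlt 8 0) (.instr (.rmove 8 0)) .skip])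
      (block [.instr (.wop .sub 6 5 0), .instr (.rload 0 6 6),
        .ite (.rlt 0 8) (.instr (.rmove 0 8)) .skip, .instr (.rstore 8 5 0)])]

/-- The lower bound of all bottoms plays the part of minus infinity for the running maximum. -/
def sweepDownInit : Code 16 := block [.instr (.rmove 8 2), .instr (.wmove 4 1)]

/-- The sides are swept in reverse order, to compute the entry heights. -/
def sweepDown : Code 16 := block [sweepDownInit, .loop (.wle 2 4) sweepDownStep]

/-- The sides from position `p` on have been swept in reverse order: the entry heights of the right
sides among them are known, and the real register `8` holds the greatest bottom of the left sides
among them. -/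
structure SweptDown (l r b : ℕ → ℝ) (n : ℕ) (ord : ℕ → ℕ) (low : ℝ) (p : ℕ) (s : Memory 16) :
    Prop where
  le_iff : ∀ z, s.rreg 8 ≤ z ↔ low ≤ z ∧ ∀ j, p ≤ j → j < 2 * n → ord j < n → b (ord j) ≤ z
  entry : ∀ j, p ≤ j → j < 2 * n → ∀ c < n, ord j = n + c → s.rarr 8 (n + c) = entry l r b n c

theorem SweptDown.left {l r b : ℕ → ℝ} {n p : ℕ} {ord : ℕ → ℕ} {low : ℝ} {s s' : Memory 16}
    (h : SweptDown l r b n ord low (p + 1) s) (hp : p < 2 * n) (he : ord p < n)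
    (h8 : s'.rreg 8 = max (s.rreg 8) (b (ord p))) (hr : s'.rarr 8 = s.rarr 8) :
    SweptDown l r b n ord low p s' := by
  constructor
  · intro z
    rw [h8, max_le_iff, h.le_iff]
    constructor
    · rintro ⟨⟨h₁, h₂⟩, h₃⟩
      refine ⟨h₁, fun j hj hjn hjo => ?_⟩
      rcases hj.eq_or_lt with rfl | hlt
      · exact h₃
      · exact h₂ j hlt hjn hjo
    · rintro ⟨h₁, h₂⟩
      exact ⟨⟨h₁, fun j hj => h₂ j (by omega)⟩, h₂ p le_rfl hp he⟩
  · intro j hj hjn c hc hjc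
    rw [hr]
    exact h.entry j (by rcases hj.eq_or_lt with rfl | hlt <;> omega) hjn c hc hjc

/-- The left sides after a right side in the order are exactly those beyond it, so the maximum of
their bottoms and of the rectangle's own bottom is the entry height. -/
theorem SweptDown.right {l r b t id : ℕ → ℝ} {n p i : ℕ} {ord : ℕ → ℕ} {low : ℝ}
    {s s' : Memory 16} (h : SweptDown l r b n ord low (p + 1) s)
    (ho : SweepOrder l r t id n ord) (hlow : ∀ i < n, low ≤ b i) (hp : p < 2 * n) (hi : i < n)
    (he : ord p = n + i) (h8 : s'.rreg 8 = s.rreg 8)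
    (hr : s'.rarr 8 = Function.update (s.rarr 8) (n + i) (max (b i) (s.rreg 8))) :
    SweptDown l r b n ord low p s' := by
  constructor
  · intro z
    rw [h8, h.le_iff]
    refine and_congr_right fun _ => ⟨fun h₂ j hj hjn hjo => ?_, fun h₂ j hj => h₂ j (by omega)⟩
    rcases hj.eq_or_lt with rfl | hlt
    · omega
    · exact h₂ j hlt hjn hjo
  · intro j hj hjn c hc hjc
    rw [hr, Function.update_apply]
    split_ifs with heq
    · obtain rfl : c = i := by omega
      -- Both maxima are compared through their upper bounds; the initial value `low` drops out,
      -- being at most `b c`.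
      refine eq_of_forall_ge_iff fun z => ?_
      rw [max_le_iff, h.le_iff, entry_le_iff]
      refine and_congr_right fun hb => ⟨?_, ?_⟩
      · rintro ⟨-, h₂⟩ i' hi' hlt
        obtain ⟨j', hj', hoj'⟩ := ho.exists_eq i' (by omega)
        have := (ho.right_left c hc i' hi' p hp j' hj' he hoj').2 hlt
        have := h₂ j' this hj' (by omega)
        rwa [hoj'] at this
      · intro h₂
        refine ⟨(hlow c hc).trans hb, fun j' hj' hjn' hjo' => ?_⟩
        exact h₂ _ hjo' ((ho.right_left c hc _ hjo' p hp j' hjn' he rfl).1 (by omega))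
    · refine h.entry j ?_ hjn c hc hjc
      rcases hj.eq_or_lt with rfl | hlt <;> omega

theorem ends_sweepDown {w L n : ℕ} {s : Memory 16} {l r b t id : ℕ → ℝ}
    (h : Loaded l r b t id n n s) (ho : SweepOrder l r t id n (s.warr 2)) (hn : s.wreg 0 = n)
    (hr : Ready (2 * n) s) (hL : 2 * (2 * n) < L) (hw : 2 * (2 * n) + 2 < 2 ^ w) :
    Ends w L sweepDown s (cost sweepDownInit + (2 * n * (cost sweepDownStep + 1) + 1 + 1))
      fun s' => Keeps s s' ∧ s'.warr = s.warr ∧ s'.rreg 3 = s.rreg 3 ∧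
        (∀ A : Fin 16, A ≠ 8 → s'.rarr A = s.rarr A) ∧
        ∀ c < n, s'.rarr 8 (n + c) = entry l r b n c := by
  have key := Ends.loop (w := w) (L := L) (b := .wle 2 4) (c := sweepDownStep)
    (fun p s' => Keeps s s' ∧ s'.warr = s.warr ∧ s'.rreg 3 = s.rreg 3 ∧
      (∀ A : Fin 16, A ≠ 8 → s'.rarr A = s.rarr A) ∧ s'.wreg 4 = p ∧ p ≤ 2 * n ∧
      SweptDown l r b n (s.warr 2) (s.rreg 2) p s') (cost sweepDownStep) ?_ ?_ (2 * n)
  · refine Ends.seq (Ends.of_wp (Q := fun s' => _) ?_) fun s' hs' =>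
      (key s' hs').seq fun s'' hs'' => Ends.of_wp ?_
    · simp only [sweepDownInit, wp_block_cons, wp_block_nil, wp_rmove, wp_wmove, hr.1]
      refine ⟨by omega, ⟨?_, fun _ _ => rfl⟩, trivial, by simp, fun _ _ => trivial, by simp, le_rfl,
        ?_, ?_⟩
      · intro d hd
        have hd4 : d ≠ 4 := by rintro rfl; simp at hd
        simp [hd4]
      · intro z
        simp only [Function.update_self]
        exact ⟨fun h => ⟨h, fun j hj hjn => by omega⟩, And.left⟩
      · intro j hj hjn
        omega
    · rw [wp_block_nil]
      obtain ⟨hk, hwa, h3, hra, -, -, hsw⟩ := hs''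
      refine ⟨hk, hwa, h3, hra, fun c hc => ?_⟩
      obtain ⟨j, hj, hoj⟩ := ho.exists_eq (n + c) (by omega)
      exact hsw.entry j (by omega) hj c hc hoj
  · rintro p s' ⟨hk, hwa, h3, hra, h4, hp, hsw⟩
    obtain ⟨-, e2, -⟩ := hk.ready hr
    have e0 : s'.wreg 0 = n := (hk.wreg 0 (by simp)).trans hn
    have r6 : s'.rarr 6 = s.rarr 6 := hra 6 (by simp)
    have hlt := ho.lt p (by omega)
    refine ⟨by simp only [Test.Holds]; omega, Ends.of_wp ?_⟩
    -- Separates what every branch preserves from the invariant at `p`, so that each branch only has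
    -- to supply the latter.
    suffices H : ∀ Q : Memory 16 → Prop, (∀ s'' : Memory 16,
        (∀ d : Fin 16, d.val < 4 → s''.wreg d = s'.wreg d) ∧ s''.warr = s'.warr ∧
          s''.rreg 3 = s'.rreg 3 ∧ (∀ A : Fin 16, A ≠ 8 → s''.rarr A = s'.rarr A) ∧
          s''.wreg 4 = p → SweptDown l r b n (s.warr 2) (s.rreg 2) p s'' → Q s'') →
        wp w L sweepDownStep Q s' by
      refine H _ ?_
      rintro s'' ⟨f1, f2, f3, f4, f5⟩ hsw'
      exact ⟨hk.trans ⟨f1, fun A hA => f4 A (by rintro rfl; simp at hA)⟩, f2.trans hwa,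
        f3.trans h3, fun A hA => (f4 A hA).trans (hra A hA), f5, by omega, hsw'⟩
    intro Q finish
    have hw4 : ∀ d : Fin 16, d.val < 4 → d ≠ 4 ∧ d ≠ 5 ∧ d ≠ 6 := by decide
    simp only [sweepDownStep, wp_block_cons, wp_block_nil, wp_wsub, wp_wload, wp_rload, wp_ite,
      wp_rmove, wp_rstore, wp_skip, Test.Holds]
    simp [e0, e2, h4, hwa, r6]
    refine ⟨by omega, by omega, by omega, fun he => ⟨by omega, ?_⟩, fun he => ⟨by omega, by omega,
      ?_⟩⟩
    · rw [h.bottom _ he]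
      refine ⟨fun hlt => finish _ ⟨fun d hd => by simp [hw4 d hd], by simp [hwa], by simp,
        by simp, by simp⟩ (hsw.left (by omega) he ?_ rfl), fun hle => finish _
        ⟨fun d hd => by simp [hw4 d hd], by simp [hwa], by simp, by simp, by simp⟩
        (hsw.left (by omega) he ?_ rfl)⟩
      · simp [max_eq_right hlt.le]
      · simp [max_eq_left hle]
    · obtain ⟨i, hi⟩ := Nat.exists_eq_add_of_le he
      have hin : i < n := by omega
      rw [hi, Nat.add_sub_cancel_left, h.bottom _ hin]
      refine ⟨fun hlt => ⟨by omega, finish _ ⟨fun d hd => by simp [hw4 d hd], by simp [hwa],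
        by simp, fun A hA => by simp [hA], by simp⟩ (hsw.right ho h.low (by omega) hin hi
        (by simp) ?_)⟩, fun hle => ⟨by omega, finish _ ⟨fun d hd => by simp [hw4 d hd],
        by simp [hwa], by simp, fun A hA => by simp [hA], by simp⟩
        (hsw.right ho h.low (by omega) hin hi (by simp) ?_)⟩⟩
      · simp [max_eq_right hlt.le]
      · simp [max_eq_left hle]
  · rintro s' ⟨hk, -, -, -, h4, -⟩
    simp only [Test.Holds, (hk.ready hr).2.1]
    omega

end RealRAM

/-! ### The forward sweep: marking the dependent rectangles. -/

namespace RealRAM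

open Tournament Pareto

/-- The right side of the rectangle `c` is at one of the first `p` positions. -/
def Swept (ord : ℕ → ℕ) (n p c : ℕ) : Prop := ∃ q < p, ord q = n + c

theorem swept_succ {ord : ℕ → ℕ} {n p c : ℕ} :
    Swept ord n (p + 1) c ↔ ord p = n + c ∨ Swept ord n p c := by
  simp only [Swept, Nat.lt_succ_iff_lt_or_eq]
  constructor
  · rintro ⟨q, hq | rfl, h⟩
    · exact .inr ⟨q, hq, h⟩
    · exact .inl h
  · rintro (h | ⟨q, hq, h⟩)
    · exact ⟨p, .inr rfl, h⟩
    · exact ⟨q, .inl hq, h⟩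

/-- When the right side of `i` is reached, the right sides already passed are precisely the
candidates in `SweepDependent` for `i`. -/
theorem _root_.Pareto.SweepOrder.swept_iff {l r t id : ℕ → ℝ} {n p i c : ℕ} {ord : ℕ → ℕ}
    (ho : SweepOrder l r t id n ord) (hp : p < 2 * n) (hi : i < n) (he : ord p = n + i)
    (hc : c < n) : Swept ord n p c ↔ SweepsBefore r t id c i := by
  constructor
  · rintro ⟨q, hq, hoq⟩
    exact (ho.right_right c hc i hi q (hq.trans hp) p hp hoq he).1 hq
  · intro h
    obtain ⟨q, hq, hoq⟩ := ho.exists_eq (n + c) (by omega)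
    exact ⟨q, (ho.right_right c hc i hi q hq p hp hoq he).2 h, hoq⟩

/-- The rectangle in word register `6` is marked, if a dependency is detected. -/
def markStep : Code 16 :=
  .ite (.rlt 8 0) (.instr (.wstore 0 6 2))
    (.ite (.req 8 0) (.ite (.rle 1 9) (.instr (.wstore 0 6 2)) .skip) .skip)

open scoped Classical in
theorem wp_markStep {w L : ℕ} {s : Memory 16} {Q : Memory 16 → Prop} (h6 : s.wreg 6 < L)
    (hQ : Q ⟨s.wreg, if s.rreg 8 < s.rreg 0 ∨ s.rreg 8 = s.rreg 0 ∧ s.rreg 1 ≤ s.rreg 9 then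
      Function.update s.warr 0 (Function.update (s.warr 0) (s.wreg 6) (s.wreg 2)) else s.warr,
      s.rreg, s.rarr⟩) :
    wp w L markStep Q s := by
  simp only [markStep, wp_ite, wp_wstore, wp_skip, Test.Holds]
  refine ⟨fun h => ⟨h6, ?_⟩, fun h => ⟨fun h' => ⟨fun h'' => ⟨h6, ?_⟩, fun h'' => ?_⟩,
    fun h' => ?_⟩⟩
  · rwa [if_pos (.inl h)] at hQ
  · rwa [if_pos (.inr ⟨h', h''⟩)] at hQ
  · rwa [if_neg (by tauto)] at hQ
  · rwa [if_neg (by tauto)] at hQ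

/-- The best right side so far is replaced by the one in word register `5`, if that is better. -/
def updateStep : Code 16 :=
  .ite (.rle 1 0) (.ite (.rle 1 8) (block [.instr (.rmove 8 1), .instr (.rload 9 4 5)]) .skip)
    .skip

open scoped Classical in
theorem wp_updateStep {w L : ℕ} {s : Memory 16} {Q : Memory 16 → Prop} (h5 : s.wreg 5 < L)
    (hQ : Q ⟨s.wreg, s.warr, if s.rreg 1 ≤ s.rreg 0 ∧ s.rreg 1 ≤ s.rreg 8 then
      Function.update (Function.update s.rreg 8 (s.rreg 1)) 9 (s.rarr 4 (s.wreg 5)) else s.rreg,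
      s.rarr⟩) :
    wp w L updateStep Q s := by
  simp only [updateStep, wp_ite, wp_block_cons, wp_block_nil, wp_rmove, wp_rload, wp_skip,
    Test.Holds]
  refine ⟨fun h => ⟨fun h' => ⟨h5, ?_⟩, fun h' => ?_⟩, fun h => ?_⟩
  · rwa [if_pos ⟨h, h'⟩] at hQ
  · rwa [if_neg (by tauto)] at hQ
  · rwa [if_neg (by tauto)] at hQ

def sweepUpStep : Code 16 :=
  block [.instr (.wload 5 2 4),
    .ite (.wlt 5 0) .skip
      (block [.instr (.wop .sub 6 5 0), .instr (.rload 0 6 5), .instr (.rload 1 4 6), markStep,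
        .instr (.rload 1 8 5), updateStep]),
    .instr (.wop .add 4 4 2)]

/-- The strict upper bound of the tops plays the part of infinity. The `0` in real register `9` is
arbitrary: it matters only when register `8` equals a top. -/
def sweepUpInit : Code 16 := block [.instr (.rmove 8 3), .instr (.rconst 9 0), .instr (.wconst 4 0)]

/-- The sides are swept in order, to mark the rectangles with a dependency in word array `0`. -/
def sweepUp : Code 16 := block [sweepUpInit, .loop (.wlt 4 1) sweepUpStep]

open scoped Classical in
/-- The rectangles in `D` are marked in the array `f`. -/
noncomputable def marked (D : ℕ → Prop) (f : ℕ → ℕ) (i : ℕ) : ℕ := if D i then 1 else f i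

theorem marked_congr {D D' : ℕ → Prop} (f : ℕ → ℕ) {i : ℕ} (h : D i ↔ D' i) :
    marked D f i = marked D' f i := by
  by_cases hD : D' i
  · rw [marked, marked, if_pos hD, if_pos (h.2 hD)]
  · rw [marked, marked, if_neg hD, if_neg fun hn => hD (h.1 hn)]

/-- The first `p` sides have been swept in order. -/
structure SweptUp (l r b t id : ℕ → ℝ) (n : ℕ) (ord f : ℕ → ℕ) (p : ℕ) (s : Memory 16) :
    Prop where
  marks : ∀ i < n, s.warr 0 i =
    marked (fun i => Swept ord n p i ∧ SweepDependent l r b t id n i) f i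
  best : Best l r b t n (Swept ord n p) (s.rreg 8) (s.rreg 9)

theorem SweptUp.left {l r b t id : ℕ → ℝ} {n p : ℕ} {ord f : ℕ → ℕ} {s s' : Memory 16}
    (h : SweptUp l r b t id n ord f p s) (he : ord p < n) (h0 : s'.warr 0 = s.warr 0)
    (h8 : s'.rreg 8 = s.rreg 8) (h9 : s'.rreg 9 = s.rreg 9) :
    SweptUp l r b t id n ord f (p + 1) s' := by
  have hS : ∀ c < n, Swept ord n (p + 1) c ↔ Swept ord n p c := fun c _ => by
    rw [swept_succ, or_iff_right (by omega)]
  constructor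
  · intro i hi
    rw [h0, h.marks i hi]
    exact marked_congr f (by rw [hS i hi])
  · rw [h8, h9]
    exact h.best.congr hS

open scoped Classical in
-- The test for `a` uses the best candidate before `a` itself enters, so the candidates are the
-- strict predecessors of `a`.
theorem SweptUp.right {l r b t id : ℕ → ℝ} {n p a : ℕ} {ord f : ℕ → ℕ} {s s' : Memory 16}
    (h : SweptUp l r b t id n ord f p s) (ho : SweepOrder l r t id n ord) (hp : p < 2 * n)
    (ha : a < n) (he : ord p = n + a)
    (h0 : s'.warr 0 = if s.rreg 8 < t a ∨ s.rreg 8 = t a ∧ l a ≤ s.rreg 9 then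
      Function.update (s.warr 0) a 1 else s.warr 0)
    (h8 : s'.rreg 8 = if entry l r b n a ≤ t a ∧ entry l r b n a ≤ s.rreg 8 then
      entry l r b n a else s.rreg 8)
    (h9 : s'.rreg 9 = if entry l r b n a ≤ t a ∧ entry l r b n a ≤ s.rreg 8 then
      r a else s.rreg 9) :
    SweptUp l r b t id n ord f (p + 1) s' := by
  have hS : ∀ c < n, Swept ord n (p + 1) c ↔ c = a ∨ Swept ord n p c := fun c _ => by
    rw [swept_succ, he]
    simp [eq_comm]
  have hB : ∀ c < n, Swept ord n p c ↔ SweepsBefore r t id c a := fun c hc =>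
    ho.swept_iff hp ha he hc
  have hdep := h.best.sweepDependent_iff ha hB
  constructor
  · intro i hi
    rw [h0]
    simp only [marked, hS i hi]
    by_cases hia : i = a
    · subst hia
      by_cases hD : SweepDependent l r b t id n i
      · rw [if_pos (hdep.1 hD)]
        simp [hD]
      · rw [if_neg fun hn => hD (hdep.2 hn), h.marks i hi]
        simp [hD, marked]
    · have := h.marks i hi
      simp only [marked] at this
      split_ifs <;> simp_all
  · rw [h8, h9]
    split_ifs with hv
    · refine h.best.insert ha hS (fun c hc hSc => ?_) hv.1 hv.2
      rcases (hB c hc).1 hSc with hlt | ⟨heq, -⟩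
      · exact hlt.le
      · exact heq.le
    · exact h.best.insert_of_not hS hv

theorem ends_sweepUp {w L n : ℕ} {s : Memory 16} {l r b t id : ℕ → ℝ}
    (h4 : ∀ i < n, s.rarr 4 i = l i) (h4' : ∀ i < n, s.rarr 4 (n + i) = r i)
    (h6 : ∀ i < n, s.rarr 6 (n + i) = t i) (h8 : ∀ i < n, s.rarr 8 (n + i) = entry l r b n i)
    (h3 : ∀ i < n, t i < s.rreg 3) (ho : SweepOrder l r t id n (s.warr 2)) (hn : s.wreg 0 = n)
    (hr : Ready (2 * n) s) (hL : 2 * (2 * n) < L) (hw : 2 * (2 * n) + 2 < 2 ^ w) :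
    Ends w L sweepUp s (cost sweepUpInit + (2 * n * (cost sweepUpStep + 1) + 1 + 1))
      fun s' => Keeps s s' ∧
        ∀ i < n, s'.warr 0 i = marked (SweepDependent l r b t id n) (s.warr 0) i := by
  have key := Ends.loop (w := w) (L := L) (b := .wlt 4 1) (c := sweepUpStep)
    (fun j s' => Keeps s s' ∧ s'.rarr = s.rarr ∧ s'.warr 2 = s.warr 2 ∧ s'.wreg 4 + j = 2 * n ∧
      SweptUp l r b t id n (s.warr 2) (s.warr 0) (s'.wreg 4) s') (cost sweepUpStep) ?_ ?_ (2 * n)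
  · refine Ends.seq (Ends.of_wp (Q := fun s' => _) ?_) fun s' hs' =>
      (key s' hs').seq fun s'' hs'' => Ends.of_wp ?_
    · simp only [sweepUpInit, wp_block_cons, wp_block_nil, wp_rmove, wp_rconst, wp_wconst]
      refine ⟨by omega, ⟨?_, fun _ _ => rfl⟩, trivial, trivial, by simp, ?_, ?_⟩
      · intro d hd
        have hd4 : d ≠ 4 := by rintro rfl; simp at hd
        simp [hd4]
      · intro i _
        simp [marked, Swept]
      · exact ⟨by simp [Swept], .inl fun i hi => by simpa using h3 i hi⟩
    · rw [wp_block_nil]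
      obtain ⟨hk, -, -, hp, hsw⟩ := hs''
      refine ⟨hk, fun i hi => ?_⟩
      rw [hsw.marks i hi]
      obtain ⟨j, hj, hoj⟩ := ho.exists_eq (n + i) (by omega)
      -- At the end every right side has been passed, so that conjunct disappears.
      exact marked_congr _ (and_iff_right ⟨j, by omega, hoj⟩)
  · rintro j s' ⟨hk, hra, hw2, hp, hsw⟩
    obtain ⟨e1, e2, -⟩ := hk.ready hr
    have e0 : s'.wreg 0 = n := (hk.wreg 0 (by simp)).trans hn
    have hlt := ho.lt (s'.wreg 4) (by omega)
    refine ⟨by simp only [Test.Holds]; omega, Ends.of_wp ?_⟩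
    have hw4 : ∀ d : Fin 16, d.val < 4 → d ≠ 4 ∧ d ≠ 5 ∧ d ≠ 6 := by decide
    simp only [sweepUpStep, wp_block_cons, wp_block_nil, wp_wload, wp_ite, wp_skip, wp_wadd,
      Test.Holds, hw2]
    refine ⟨by omega, by omega, fun he => ?_, fun he => ?_⟩
    · have he : s.warr 2 (s'.wreg 4) < n := by simpa [e0] using he
      refine ⟨by simp [e2]; omega, hk.trans ⟨fun d hd => by simp [hw4 d hd], fun _ _ => rfl⟩, hra,
        trivial, by simp [e2]; omega, ?_⟩
      simp only [ne_eq, Fin.isValue, Fin.reduceEq, not_false_eq_true, Function.update_of_ne,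
        Function.update_self, e2]
      exact hsw.left he rfl rfl rfl
    · have he : n ≤ s.warr 2 (s'.wreg 4) := by simpa [e0] using he
      obtain ⟨a, ha⟩ := Nat.exists_eq_add_of_le he
      have han : a < n := by omega
      simp only [wp_wsub, wp_rload]
      simp only [ne_eq, Fin.isValue, Fin.reduceEq, not_false_eq_true, Function.update_of_ne,
        Function.update_self, e0, ha, Nat.add_sub_cancel_left, hra, h6 a han, h4 a han]
      refine ⟨by omega, by omega, by omega, wp_markStep (by simp; omega) ?_⟩
      refine ⟨by simp; omega, wp_updateStep (by simp; omega) ?_⟩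
      simp [e2, h8 a han, h4' a han]
      refine ⟨by omega, hk.trans ⟨fun d hd => by simp [hw4 d hd], fun A _ => by rw [hra]⟩, ?_,
        by omega, hsw.right ho (by omega) han ha ?_ ?_ ?_⟩
      · split_ifs <;> simp [hw2]
      · split_ifs <;> simp
      · split_ifs <;> simp
      · split_ifs <;> simp
  · rintro s' ⟨hk, -, -, hp, -⟩
    simp only [Test.Holds, (hk.ready hr).1]
    omega

/-- All rectangles with a dependency that the sweep detects are marked. The left, right, bottom and
top coordinates are in the real arrays `A`, `B`, `C`, `D`. -/
def sweep (A B C D : Fin 16) (σ : ℚ) : Code 16 := block [load A B C D σ, sort, sweepDown, sweepUp]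

def sweepTime (A B C D : Fin 16) (σ : ℚ) (n : ℕ) : ℕ :=
  (cost (loadInit σ) + (n * (cost (loadStep A B C D) + 1) + 1 + 1)) + (sortTime (2 * n) +
    ((cost sweepDownInit + (2 * n * (cost sweepDownStep + 1) + 1 + 1)) +
      ((cost sweepUpInit + (2 * n * (cost sweepUpStep + 1) + 1 + 1)) + 1)))

theorem ends_sweep {w L n : ℕ} {s : Memory 16} {l r b t : ℕ → ℝ} {σ : ℚ} {A B C D : Fin 16}
    (hσ : σ ≠ 0) (hA : A.val < 4) (hB : B.val < 4) (hC : C.val < 4) (hD : D.val < 4)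
    (hn : s.wreg 0 = n) (hr : Ready (2 * n) s) (hL : 2 * (2 * n) < L)
    (hw : 2 * (2 * n) + 2 < 2 ^ w) (hl : s.rarr A = l) (hr' : s.rarr B = r) (hb : s.rarr C = b)
    (ht : s.rarr D = t) :
    Ends w L (sweep A B C D σ) s (sweepTime A B C D σ n) fun s' => Keeps s s' ∧
      ∀ i < n, s'.warr 0 i =
        marked (SweepDependent l r b t (fun i => σ * i) n) (s.warr 0) i := by
  refine (ends_load σ hA hB hC hD hn hr hL hw hl hr' hb ht).seq fun s₁ ⟨hk₁, hw₁, h₁⟩ => ?_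
  refine (ends_sort (hk₁.ready hr) hL hw).seq fun s₂ ⟨hf₂, hsel⟩ => ?_
  have hk₂ := hk₁.trans hf₂.keeps
  have ho := h₁.sweepOrder (fun i _ i' _ h => by simpa [hσ] using h) hsel
  have h₂ : Loaded l r b t (fun i => σ * i) n n s₂ := by
    obtain ⟨a₁, a₂, a₃, a₄, a₅, a₆, a₇, a₈, a₉, a₀⟩ := h₁
    constructor <;> (try rw [hf₂.rarr]) <;> (try rw [hf₂.rreg _ (by simp)]) <;> assumption
  have hn₂ := (hk₂.wreg 0 (by simp)).trans hn
  refine (ends_sweepDown h₂ ho hn₂ (hk₂.ready hr) hL hw).seq fun s₃ ⟨hk₃, hw₃, h3, hra, hG⟩ => ?_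
  have hk₃' := hk₂.trans hk₃
  refine (ends_sweepUp (s := s₃) (t := t) (id := fun i => σ * i) ?_ ?_ ?_ hG ?_ (by rwa [hw₃])
    ((hk₃'.wreg 0 (by simp)).trans hn) (hk₃'.ready hr) hL hw).seq fun s₄ ⟨hk₄, hm⟩ =>
    Ends.of_wp ⟨hk₃'.trans hk₄, fun i hi => ?_⟩
  · rw [hra 4 (by simp)]; exact h₂.left
  · rw [hra 4 (by simp)]; exact h₂.right
  · rw [hra 6 (by simp)]; exact h₂.top
  · rw [h3]; exact h₂.high
  · rw [hm i hi, hw₃, hf₂.warr 0 (by simp) (by simp), hw₁]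

end RealRAM

/-! ### The complete program, its running time and its memory. -/

namespace RealRAM

open Tournament Pareto

def invertStep : Code 16 :=
  block [.instr (.wload 5 0 4), .instr (.wop .sub 5 2 5), .instr (.wstore 0 4 5),
    .instr (.wop .add 4 4 2)]

/-- The characteristic vector in word array `0` is replaced by that of the complement. -/
def invert : Code 16 := block [.instr (.wconst 4 0), .loop (.wlt 4 0) invertStep]

theorem ends_invert {w L n : ℕ} {s : Memory 16} (hn : s.wreg 0 = n) (h2 : s.wreg 2 = 1)
    (hL : n < L) (hw : n + 1 < 2 ^ w) (hle : ∀ i < n, s.warr 0 i ≤ 1) :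
    Ends w L invert s (1 + (n * (cost invertStep + 1) + 1 + 1)) fun s' =>
      ∀ i < n, s'.warr 0 i = 1 - s.warr 0 i := by
  have key := Ends.loop (w := w) (L := L) (b := .wlt 4 0) (c := invertStep)
    (fun j s' => s'.wreg 0 = n ∧ s'.wreg 2 = 1 ∧ s'.wreg 4 + j = n ∧
      (∀ i < s'.wreg 4, s'.warr 0 i = 1 - s.warr 0 i) ∧
      ∀ i, s'.wreg 4 ≤ i → s'.warr 0 i = s.warr 0 i) (cost invertStep) ?_ ?_ n
  · refine Ends.seq (Ends.of_wp (Q := fun s' => _) ?_) fun s' hs' =>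
      (key s' hs').seq fun s'' hs'' => Ends.of_wp ?_
    · rw [wp_wconst]
      exact ⟨by omega, by simp [hn], by simp [h2], by simp, by simp, by simp⟩
    · rw [wp_block_nil]
      obtain ⟨-, -, h4, h, -⟩ := hs''
      exact fun i hi => h i (by omega)
  · rintro j s' ⟨e0, e2, h4, hlt, hge⟩
    refine ⟨by simp only [Test.Holds]; omega, Ends.of_wp ?_⟩
    have := hle (s'.wreg 4) (by omega)
    simp only [invertStep, wp_block_cons, wp_block_nil, wp_wload, wp_wsub, wp_wstore, wp_wadd]
    simp [e0, e2, hge]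
    refine ⟨by omega, by omega, by omega, by omega, by omega, by omega, ?_, ?_⟩
    · intro i hi
      rw [Function.update_apply]
      split_ifs with heq
      · rw [heq]
      · exact hlt i (by omega)
    · intro i hi
      rw [Function.update_of_ne (by omega)]
      exact hge i (by omega)
  · rintro s' ⟨e0, -, h4, -⟩
    simp only [Test.Holds]
    omega

def setConstants : Code 16 :=
  block [.instr (.wconst 2 1), .instr (.wconst 3 2), .instr (.wop .mul 1 0 3)]

/-- The program that computes the independent rectangles. -/
def findIndependent : Code 16 :=
  block [setConstants, sweep 0 1 2 3 1, sweep 2 3 0 1 (-1), invert]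

def findIndependentTime (n : ℕ) : ℕ :=
  cost setConstants + (sweepTime 0 1 2 3 1 n + (sweepTime 2 3 0 1 (-1) n +
    ((1 + (n * (cost invertStep + 1) + 1 + 1)) + 1)))

/-- The second sweep swaps the coordinates and negates the identifiers. It only adds marks, so the
marks form the union of both kinds of dependency, and the complement is the answer. -/
theorem ends_findIndependent {w L n : ℕ} {s : Memory 16} (hn : s.wreg 0 = n)
    (hL : 2 * (2 * n) < L) (hw : 2 * (2 * n) + 2 < 2 ^ w) (h0 : ∀ i < n, s.warr 0 i = 0) :
    Ends w L findIndependent s (findIndependentTime n) fun s' => ∀ i < n,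
      (SweepDependent (s.rarr 0) (s.rarr 1) (s.rarr 2) (s.rarr 3) (fun i => 1 * i) n i ∨
        SweepDependent (s.rarr 2) (s.rarr 3) (s.rarr 0) (s.rarr 1) (fun i => -1 * i) n i →
          s'.warr 0 i = 0) ∧
      (¬ (SweepDependent (s.rarr 0) (s.rarr 1) (s.rarr 2) (s.rarr 3) (fun i => 1 * i) n i ∨
        SweepDependent (s.rarr 2) (s.rarr 3) (s.rarr 0) (s.rarr 1) (fun i => -1 * i) n i) →
          s'.warr 0 i = 1) := by
  refine Ends.seq (R := fun s' => s'.wreg 0 = n ∧ Ready (2 * n) s' ∧ s'.warr = s.warr ∧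
    s'.rarr = s.rarr) (Ends.of_wp ?_) fun s₁ ⟨e₁, hr₁, hw₁, hra₁⟩ => ?_
  · simp only [setConstants, wp_block_cons, wp_block_nil, wp_wconst, wp_wmul]
    exact ⟨by omega, by omega, by simp [hn]; omega, by simp [hn],
      ⟨by simp [hn, mul_comm], by simp, by simp⟩, trivial, trivial⟩
  refine (ends_sweep (σ := 1) (by norm_num) (by simp) (by simp) (by simp) (by simp) e₁ hr₁ hL hw
    rfl rfl rfl rfl).seq fun s₂ ⟨hk₂, hm₂⟩ => ?_
  refine (ends_sweep (σ := -1) (by norm_num) (by simp) (by simp) (by simp) (by simp)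
    ((hk₂.wreg 0 (by simp)).trans e₁) (hk₂.ready hr₁) hL hw (hk₂.rarr 2 (by simp))
    (hk₂.rarr 3 (by simp)) (hk₂.rarr 0 (by simp)) (hk₂.rarr 1 (by simp))).seq
    fun s₃ ⟨hk₃, hm₃⟩ => ?_
  have hk := hk₂.trans hk₃
  simp only [Rat.cast_one, Rat.cast_neg, hra₁] at hm₂ hm₃
  have hD : ∀ i < n, s₃.warr 0 i = marked (fun i =>
      SweepDependent (s.rarr 0) (s.rarr 1) (s.rarr 2) (s.rarr 3) (fun i => 1 * i) n i ∨
        SweepDependent (s.rarr 2) (s.rarr 3) (s.rarr 0) (s.rarr 1) (fun i => -1 * i) n i)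
      (fun _ => 0) i := fun i hi => by
    rw [hm₃ i hi, marked, hm₂ i hi, marked, marked, hw₁, h0 i hi]
    split_ifs <;> tauto
  refine (ends_invert ((hk.wreg 0 (by simp)).trans e₁) (hk.ready hr₁).2.1 (by omega) (by omega)
    fun i hi => ?_).seq fun s₄ hs₄ => Ends.of_wp fun i hi => ?_
  · rw [hD i hi, marked]
    split_ifs <;> simp
  · rw [hs₄ i hi, hD i hi, marked]
    split_ifs with h
    · exact ⟨fun _ => rfl, fun hn => absurd h hn⟩
    · exact ⟨fun hp => absurd hp h, fun _ => rfl⟩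

/-- The tree holds `2 * n` items, so its paths are bounded by the logarithm of `4 * n`, which is
that of `n` plus two. For `n ≥ 2` this is at most three times the logarithm of `n`. -/
theorem mul_log_bounds {n : ℕ} (hn : 2 ≤ n) :
    n ≤ n * Nat.log 2 n ∧ n * Nat.log 2 (2 * (2 * n)) ≤ 3 * (n * Nat.log 2 n) := by
  have h1 : 1 ≤ Nat.log 2 n := Nat.log_pos one_lt_two hn
  have h2 : Nat.log 2 (2 * (2 * n)) = Nat.log 2 n + 2 := by
    rw [mul_comm, Nat.log_mul_base one_lt_two (by omega), mul_comm,
      Nat.log_mul_base one_lt_two (by omega)]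
  refine ⟨Nat.le_mul_of_pos_right _ h1, ?_⟩
  rw [h2]
  nlinarith

theorem findIndependentTime_le {n : ℕ} (hn : 2 ≤ n) :
    findIndependentTime n ≤ 10000 * (n * Nat.log 2 n) := by
  obtain ⟨h1, h2⟩ := mul_log_bounds hn
  simp only [findIndependentTime, sweepTime, sortTime, extractStepTime, setConstants, invertStep,
    sweepUpInit, sweepUpStep, updateStep, markStep, sweepDownInit, sweepDownStep, loadInit,
    loadStep, climbStep, refresh, pick, compareOn, takeRoot, buildStep, leavesStep, block, cost]
  ring_nf at h1 h2 ⊢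
  norm_num
  omega

theorem natLog_isBigO : (fun n : ℕ => (Nat.log 2 n : ℝ)) =O[Filter.atTop]
    (fun n : ℕ => Real.log n) := by
  refine Asymptotics.IsBigO.of_bound (1 / Real.log 2) ?_
  filter_upwards [Filter.eventually_ge_atTop 1] with n hn
  have h2 : 0 < Real.log 2 := Real.log_pos one_lt_two
  have hn' : (0 : ℝ) < n := by exact_mod_cast hn
  rw [Real.norm_of_nonneg (Nat.cast_nonneg _),
    Real.norm_of_nonneg (Real.log_nonneg (by exact_mod_cast hn)), one_div, inv_mul_eq_div,
    le_div_iff₀ h2, ← Real.log_pow]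
  refine Real.log_le_log (by positivity) ?_
  exact_mod_cast Nat.pow_log_le_self 2 (by omega)

end RealRAM

open RealRAM Pareto in
theorem RealRAM.computesIndependentRegions_findIndependent :
    ComputesIndependentRegions (k := 12) findIndependent (fun n => Nat.log 2 n + 5)
      findIndependentTime (fun n => cells 16 (4 * n + 1)) := by
  intro n F
  -- From `n < 2 ^ (Nat.log 2 n + 1)`; the spare bits hold tree indices up to `4 * n` and cover `n =
  -- 0`.
  have hw : 2 * (2 * n) + 2 < 2 ^ (Nat.log 2 n + 5) := by
    have := Nat.lt_pow_succ_log_self one_lt_two n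
    rw [pow_succ] at this
    rw [pow_add]
    omega
  refine ⟨lt_of_le_of_lt (by omega) hw, 4 * n + 1, by omega, le_rfl, ?_⟩
  obtain ⟨t, s, hrun, ht, hs⟩ := ends_findIndependent (w := Nat.log 2 n + 5) (L := 4 * n + 1)
    (n := n) (s := inputMemory 12 F) (by simp [inputMemory]) (by omega) hw
    (fun i _ => by simp [inputMemory])
  refine ⟨t, s, hrun, ht, fun i => ?_⟩
  have hdep := exists_outgoingDependency_iff F (l := (inputMemory 12 F).rarr 0)
    (r := (inputMemory 12 F).rarr 1) (b := (inputMemory 12 F).rarr 2)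
    (t := (inputMemory 12 F).rarr 3) (fun i => by simp [inputMemory])
    (fun i => by simp [inputMemory]) (fun i => by simp [inputMemory])
    (fun i => by simp [inputMemory]) i
  obtain ⟨h0, h1⟩ := hs i i.2
  have hmem : i ∈ independentRegions F ↔ ¬ ∃ c, OutgoingDependency F i c := by
    simp [independentRegions]
  rw [hmem, hdep]
  exact ⟨fun h => h1 h, fun h => h0 (not_not.1 h)⟩

theorem lemma5p4 :
    ∃ (k : ℕ) (c : RealRAM.Code (k + 4)) (wordBits time space : ℕ → ℕ),
      Pareto.ComputesIndependentRegions c wordBits time space ∧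
      (fun n : ℕ => (time n : ℝ)) =O[Filter.atTop] (fun n : ℕ => (n : ℝ) * Real.log n) ∧
      (fun n : ℕ => (space n : ℝ)) =O[Filter.atTop] (fun n : ℕ => (n : ℝ)) ∧
      (fun n : ℕ => (wordBits n : ℝ)) =O[Filter.atTop] (fun n : ℕ => Real.log n) := by
  refine ⟨12, RealRAM.findIndependent, fun n => Nat.log 2 n + 5, RealRAM.findIndependentTime,
    fun n => RealRAM.cells 16 (4 * n + 1),
    RealRAM.computesIndependentRegions_findIndependent, ?_, ?_, ?_⟩
  · refine Asymptotics.IsBigO.trans (g := fun n : ℕ => (n : ℝ) * (Nat.log 2 n : ℝ)) ?_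
      ((Asymptotics.isBigO_refl _ _).mul RealRAM.natLog_isBigO)
    refine Asymptotics.IsBigO.of_bound 10000 ?_
    filter_upwards [Filter.eventually_ge_atTop 2] with n hn
    rw [Real.norm_of_nonneg (by positivity), Real.norm_of_nonneg (by positivity)]
    exact_mod_cast RealRAM.findIndependentTime_le hn
  · refine Asymptotics.IsBigO.of_bound 1000 ?_
    filter_upwards [Filter.eventually_ge_atTop 1] with n hn
    rw [Real.norm_of_nonneg (by positivity), Real.norm_of_nonneg (by positivity)]
    -- The count is `32 * (4 * n + 2)`, so the constant is generous for `n ≥ 1`.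
    have : RealRAM.cells 16 (4 * n + 1) ≤ 1000 * n := by
      simp only [RealRAM.cells]
      omega
    exact_mod_cast this
  · refine Asymptotics.IsBigO.trans (g := fun n : ℕ => (Nat.log 2 n : ℝ)) ?_ RealRAM.natLog_isBigO
    refine Asymptotics.IsBigO.of_bound 6 ?_
    filter_upwards [Filter.eventually_ge_atTop 2] with n hn
    rw [Real.norm_of_nonneg (by positivity), Real.norm_of_nonneg (by positivity)]
    have h : Nat.log 2 n + 5 ≤ 6 * Nat.log 2 n := by
      have := Nat.log_pos one_lt_two hn
      omega
    exact_mod_cast h
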